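/- Let $n\in\mathbb N$, let $\Xi=\mathbb R^{n}\times\mathbb R^{n}$ with points $X=(x,\xi)$, $Y=(y,\eta)$, symplectic form $\sigma(X,Y)=y\cdot\xi-x\cdot\eta$ and Haar measure $dX=(2\pi)^{-n}dx\,d\xi$. Put $\langle f,g\rangle=\int_\Xi f(X)g(X)\,dX$ and $\langle\!\langle F,G\rangle\!\rangle=\int_\Xi\int_\Xi F(X,Y)G(X,Y)\,dX\,dY$, with the same notation for the dualities between tempered distributions and Schwartz functions, and let $\widehat f(Y)=\int_\Xi e^{-i\sigma(Y,Z)}f(Z)\,dZ$. The spaces $\mathcal S'$ of complex tempered distributions carry the strong dual topology, and Schwartz functions are regarded as distributions through these dualities. Let $\#:\mathcal S(\Xi)\times\mathcal S(\Xi)\to\mathcal S(\Xi)$ be a bilinear map satisfying: Hypothesis A. (1) $\#$ is separately continuous and makes $\mathcal S(\Xi)$, with complex conjugation as involution, an associative $^*$-algebra; (2) $\int_\Xi (f\#g)(X)\,dX=\int_\Xi f(X)g(X)\,dX$ for all $f,g\in\mathcal S(\Xi)$. For $u\in\mathcal S'(\Xi)$ and $f\in\mathcal S(\Xi)$ define $f\#u,\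 u\#f\in\mathcal S'(\Xi)$ by $\langle f\#u,h\rangle=\langle u,h\#f\rangle$ and $\langle u\#f,h\rangle=\langle u,f\#h\rangle$ for $h\in\mathcal S(\Xi)$. Hypothesis B. $f_1\#u\#f_2\in\mathcal S(\Xi)$ for all $f_1,f_2\in\mathcal S(\Xi)$ and $u\in\mathcal S'(\Xi)$. Then there are unique continuous linear maps $\mathbf R,\mathbf N:\mathcal S(\Xi\times\Xi)\to\mathcal S'(\Xi\times\Xi)$ such that, for all $f_1,f_2,g_1,g_2\in\mathcal S(\Xi)$, $$\langle\!\langle \mathbf R(f_1\otimes f_2),g_1\otimes g_2\rangle\!\rangle=\langle g_1\#f_1,g_2\#f_2\rangle,\qquad \langle\!\langle \mathbf N(f_1\otimes f_2),g_1\otimes g_2\rangle\!\rangle=\langle \widehat g_1\#f_1,\widehat g_2\#f_2\rangle .$$ Let $C(X,Y)=(-X,X-Y)$ and let $\mathbf M$ be the map $\mathbf M(F)=\mathbf N(F)\circ C$, where composition of a distribution with $C$ is defined by $\langle\!\langle u\circ C,G\rangle\!\rangle=\langle\!\langle u,G\circ C^{-1}\rangle\!\rangle$. Then each of $\mathbf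 R$, $\mathbf N$, $\mathbf M$ takes values in $\mathcal S(\Xi\times\Xi)$, is a continuous linear map of $\mathcal S(\Xi\times\Xi)$ into itself, and extends uniquely to a continuous linear map of $\mathcal S'(\Xi\times\Xi)$ into itself. The same holds for the map $F\mapsto\mathbf N(F\circ C)$, and the unique extension property also holds when $\mathcal S'(\Xi\times\Xi)$ carries the weak topology instead of the strong one. -/

import Mathlib

open MeasureTheory
open scoped SchwartzMap FourierTransform NNReal

noncomputable section

namespace AbstractComposition

/-! ### Phase space, symplectic form, normalised Lebesgue measure -/

/-- The phase space `Ξ = ℝⁿ × (ℝⁿ)' = ℝ²ⁿ`. A point `X` stands for `(x, ξ)` with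
`x i = X (Sum.inl i)` and `ξ i = X (Sum.inr i)`. -/
abbrev Phase (n : ℕ) : Type := EuclideanSpace ℝ (Fin n ⊕ Fin n)

/-- The symplectic form `σ((x, ξ), (y, η)) = y · ξ - x · η`. -/
def sigma {n : ℕ} (X Y : Phase n) : ℝ :=
  (∑ i, Y (Sum.inl i) * X (Sum.inr i)) - ∑ i, X (Sum.inl i) * Y (Sum.inr i)

/-- The constant `(2π)⁻ⁿ` for which the symplectic Fourier transform is unitary on `L²(Ξ)`. -/
def haarConst (n : ℕ) : ℝ≥0 := ⟨((2 * Real.pi) ^ n)⁻¹, by positivity⟩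

lemma haarConst_ne_zero (n : ℕ) : haarConst n ≠ 0 := by
  intro h
  have h' : ((2 * Real.pi) ^ n)⁻¹ = (0 : ℝ) := congrArg NNReal.toReal h
  have : (0 : ℝ) < ((2 * Real.pi) ^ n)⁻¹ := by positivity
  exact this.ne' h'

/-- The Haar measure `dX = (2π)⁻ⁿ dx dξ` on `Ξ`. -/
def phaseMeasure (n : ℕ) : Measure (Phase n) := haarConst n • volume

instance (n : ℕ) : (phaseMeasure n).IsAddHaarMeasure :=
  Measure.IsAddHaarMeasure.nnreal_smul volume (haarConst_ne_zero n)

/-- The Haar measure `dX dY` on `Ξ × Ξ`. -/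
def doubleMeasure (n : ℕ) : Measure (Phase n × Phase n) :=
  (phaseMeasure n).prod (phaseMeasure n)

instance (n : ℕ) : SigmaFinite (phaseMeasure n) :=
  inferInstanceAs (SigmaFinite (haarConst n • (volume : Measure (Phase n))))

instance (n : ℕ) : (doubleMeasure n).IsAddHaarMeasure :=
  inferInstanceAs ((phaseMeasure n).prod (phaseMeasure n)).IsAddHaarMeasure

/-! ### The symplectic Fourier transform on Schwartz functions -/

/-- The linear bijection `Y = (y, η) ↦ (2π)⁻¹ (η, -y)`, so that `2π ⟪Z, J Y⟫ = σ(Y, Z)`. -/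
def symplecticMap (n : ℕ) : Phase n ≃L[ℝ] Phase n :=
  LinearEquiv.toContinuousLinearEquiv
    { toFun := fun Y => WithLp.toLp 2 (Sum.elim (fun i => (2 * Real.pi)⁻¹ * Y (Sum.inr i))
        (fun i => -((2 * Real.pi)⁻¹ * Y (Sum.inl i))))
      map_add' := by
        intro Y Z
        ext (i | i) <;> simp <;> ring
      map_smul' := by
        intro c Y
        ext (i | i) <;> simp <;> ring
      invFun := fun Y => WithLp.toLp 2 (Sum.elim (fun i => -((2 * Real.pi) * Y (Sum.inr i)))
        (fun i => (2 * Real.pi) * Y (Sum.inl i)))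
      left_inv := by
        intro Y
        ext (i | i) <;> simp <;> field_simp
      right_inv := by
        intro Y
        ext (i | i) <;> simp <;> field_simp }

lemma inner_symplecticMap {n : ℕ} (Y Z : Phase n) :
    2 * Real.pi * inner ℝ Z (symplecticMap n Y) = sigma Y Z := by
  have h : symplecticMap n Y =
      WithLp.toLp 2 (Sum.elim (fun i => (2 * Real.pi)⁻¹ * Y (Sum.inr i))
        (fun i => -((2 * Real.pi)⁻¹ * Y (Sum.inl i)))) := rfl
  rw [h, PiLp.inner_apply, Fintype.sum_sum_type]
  simp only [sigma, Sum.elim_inl, Sum.elim_inr, RCLike.inner_apply, conj_trivial]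
  rw [mul_add, Finset.mul_sum, Finset.mul_sum, sub_eq_add_neg, ← Finset.sum_neg_distrib]
  congr 1 <;> refine Finset.sum_congr rfl fun i _ => ?_ <;> field_simp

/-- The symplectic Fourier transform on `𝓢(Ξ)`; see `symplecticFourier_apply`. -/
def symplecticFourier (n : ℕ) : 𝓢(Phase n, ℂ) →L[ℂ] 𝓢(Phase n, ℂ) :=
  ((haarConst n : ℝ) : ℂ) •
    ((SchwartzMap.compCLMOfContinuousLinearEquiv ℂ (symplecticMap n)).comp
      (FourierTransform.fourierCLM ℂ 𝓢(Phase n, ℂ)))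

/-- `(𝔉 f)(Y) = ∫ e^{-iσ(Y,Z)} f(Z) dZ`. -/
theorem symplecticFourier_apply {n : ℕ} (f : 𝓢(Phase n, ℂ)) (Y : Phase n) :
    symplecticFourier n f Y
      = ∫ Z, Complex.exp (-(Complex.I * (sigma Y Z : ℂ))) * f Z ∂(phaseMeasure n) := by
  have h : symplecticFourier n f Y =
      ((haarConst n : ℝ) : ℂ) * (𝓕 (f : Phase n → ℂ)) (symplecticMap n Y) := rfl
  rw [h, Real.fourier_eq', phaseMeasure, integral_smul_nnreal_measure, NNReal.smul_def,
    Complex.real_smul]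
  congr 1
  refine integral_congr_ae (Filter.Eventually.of_forall fun Z => ?_)
  simp only [smul_eq_mul]
  congr 2
  rw [← inner_symplecticMap]
  push_cast
  ring

/-! ### Tempered distributions and dualities

The space of tempered distributions on `E` is `StrongDual ℂ 𝓢(E, ℂ)`, the topological dual of
`𝓢(E, ℂ)` with the topology of uniform convergence on bounded sets. With the weak topology it is
`𝓢'(E, ℂ)`. -/

/-- A Schwartz function as a tempered distribution: `G ↦ ∫ G(x) F(x) dμ(x)`. -/
def toDist {E : Type*} [NormedAddCommGroup E] [NormedSpace ℝ E] [MeasurableSpace E]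
    [BorelSpace E] [SecondCountableTopology E] (μ : Measure E) [μ.HasTemperateGrowth]
    (F : 𝓢(E, ℂ)) : StrongDual ℂ 𝓢(E, ℂ) :=
  (SchwartzMap.integralCLM ℂ μ).comp
    (SchwartzMap.pairing (ContinuousLinearMap.lsmul ℂ ℂ).flip F)

lemma toDist_apply {E : Type*} [NormedAddCommGroup E] [NormedSpace ℝ E] [MeasurableSpace E]
    [BorelSpace E] [SecondCountableTopology E] (μ : Measure E) [μ.HasTemperateGrowth]
    (F G : 𝓢(E, ℂ)) : toDist μ F G = ∫ x, G x * F x ∂μ := by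
  rw [toDist, ContinuousLinearMap.comp_apply, SchwartzMap.integralCLM_apply]
  simp

/-- The "real" scalar product `⟨f, g⟩ = ∫ f(X) g(X) dX`. -/
def pair {n : ℕ} (f g : 𝓢(Phase n, ℂ)) : ℂ := ∫ X, f X * g X ∂(phaseMeasure n)

/-- The elementary tensor `(f ⊗ g)(X, Y) = f(X) g(Y)`. -/
def tensor {n : ℕ} (f g : 𝓢(Phase n, ℂ)) : 𝓢(Phase n × Phase n, ℂ) where
  toFun P := f P.1 * g P.2
  smooth' := ((f.smooth ⊤).comp contDiff_fst).mul ((g.smooth ⊤).comp contDiff_snd)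
  decay' := by
    intro k N
    have hfst : ∀ (h : 𝓢(Phase n, ℂ)) (L : Phase n × Phase n →L[ℝ] Phase n), ‖L‖ ≤ 1 →
        ∀ (i : ℕ) (P : Phase n × Phase n),
        ‖iteratedFDeriv ℝ i (fun P => h (L P)) P‖ ≤ ‖iteratedFDeriv ℝ i h (L P)‖ := by
      intro h L hL i P
      have e := L.iteratedFDeriv_comp_right (f := (h : Phase n → ℂ)) (h.smooth ⊤) P
        (i := i) (by exact_mod_cast le_top)
      have e' : iteratedFDeriv ℝ i (fun P => h (L P)) P =
          (iteratedFDeriv ℝ i h (L P)).compContinuousLinearMap fun _ => L := e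
      rw [e']
      refine (ContinuousMultilinearMap.norm_compContinuousLinearMap_le _ _).trans ?_
      refine mul_le_of_le_one_right (norm_nonneg _) ?_
      exact Finset.prod_le_one (fun _ _ => norm_nonneg _) (fun _ _ => hL)
    have hL1 := hfst f (ContinuousLinearMap.fst ℝ _ _) (ContinuousLinearMap.norm_fst_le ..)
    have hL2 := hfst g (ContinuousLinearMap.snd ℝ _ _) (ContinuousLinearMap.norm_snd_le ..)
    have hf : ∀ k i : ℕ, ∃ C : ℝ, 0 < C ∧ ∀ x, ‖x‖ ^ k * ‖iteratedFDeriv ℝ i f x‖ ≤ C := f.decay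
    have hg : ∀ k i : ℕ, ∃ C : ℝ, 0 < C ∧ ∀ x, ‖x‖ ^ k * ‖iteratedFDeriv ℝ i g x‖ ≤ C := g.decay
    choose A hA0 hA using hf
    choose B hB0 hB using hg
    refine ⟨∑ i ∈ Finset.range (N + 1), (N.choose i : ℝ) *
      (A k i * B 0 (N - i) + A 0 i * B k (N - i)), fun P => ?_⟩
    have hmul := norm_iteratedFDeriv_mul_le (𝕜 := ℝ) (n := N) (N := ((⊤ : ℕ∞) : WithTop ℕ∞))
      (f := fun P : Phase n × Phase n => f P.1) (g := fun P : Phase n × Phase n => g P.2)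
      ((f.smooth ⊤).comp contDiff_fst) ((g.smooth ⊤).comp contDiff_snd) P
      (by exact_mod_cast le_top)
    refine (mul_le_mul_of_nonneg_left hmul (by positivity)).trans ?_
    rw [Finset.mul_sum]
    refine Finset.sum_le_sum fun i _ => ?_
    have h1 : ‖iteratedFDeriv ℝ i (fun P : Phase n × Phase n => f P.1) P‖
        ≤ ‖iteratedFDeriv ℝ i f P.1‖ := hL1 i P
    have h2 : ‖iteratedFDeriv ℝ (N - i) (fun P : Phase n × Phase n => g P.2) P‖
        ≤ ‖iteratedFDeriv ℝ (N - i) g P.2‖ := hL2 (N - i) P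
    have hA1 := hA k i P.1
    have hA2 := hA 0 i P.1
    have hB1 := hB k (N - i) P.2
    have hB2 := hB 0 (N - i) P.2
    rw [pow_zero, one_mul] at hA2 hB2
    have hP : ‖P‖ ^ k ≤ ‖P.1‖ ^ k + ‖P.2‖ ^ k := by
      rw [Prod.norm_def]
      rcases max_choice ‖P.1‖ ‖P.2‖ with h | h <;> rw [h]
      · exact le_add_of_nonneg_right (by positivity)
      · exact le_add_of_nonneg_left (by positivity)
    calc ‖P‖ ^ k * ((N.choose i : ℝ) * ‖iteratedFDeriv ℝ i (fun P : Phase n × Phase n => f P.1) P‖ *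
          ‖iteratedFDeriv ℝ (N - i) (fun P : Phase n × Phase n => g P.2) P‖)
        ≤ (‖P.1‖ ^ k + ‖P.2‖ ^ k) * ((N.choose i : ℝ) * ‖iteratedFDeriv ℝ i f P.1‖ *
          ‖iteratedFDeriv ℝ (N - i) g P.2‖) := by gcongr
      _ = (N.choose i : ℝ) * ((‖P.1‖ ^ k * ‖iteratedFDeriv ℝ i f P.1‖) *
            ‖iteratedFDeriv ℝ (N - i) g P.2‖ + ‖iteratedFDeriv ℝ i f P.1‖ *
            (‖P.2‖ ^ k * ‖iteratedFDeriv ℝ (N - i) g P.2‖)) := by ring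
      _ ≤ _ := by
        have := (hA0 k i).le
        have := (hA0 0 i).le
        gcongr

@[simp] lemma tensor_apply {n : ℕ} (f g : 𝓢(Phase n, ℂ)) (P : Phase n × Phase n) :
    tensor f g P = f P.1 * g P.2 := rfl

/-! ### Composition laws -/

/-- The involution of `𝓢(Ξ)`: complex conjugation `f ↦ \bar f`. -/
def conjS {n : ℕ} (f : 𝓢(Phase n, ℂ)) : 𝓢(Phase n, ℂ) :=
  SchwartzMap.postcompCLM (𝕜 := ℝ) (Complex.conjCLE : ℂ →L[ℝ] ℂ) f

@[simp] lemma conjS_apply {n : ℕ} (f : 𝓢(Phase n, ℂ)) (X : Phase n) :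
    conjS f X = (starRingEnd ℂ) (f X) := rfl

/-- Hypothesis A for a bilinear composition law `#` on `𝓢(Ξ)`: it makes `𝓢(Ξ)`, with complex
conjugation, an (associative) `*`-algebra; it is separately continuous; and
`∫ (f # g)(X) dX = ∫ f(X) g(X) dX`. -/
structure HypothesisA {n : ℕ}
    (mul : 𝓢(Phase n, ℂ) →ₗ[ℂ] 𝓢(Phase n, ℂ) →ₗ[ℂ] 𝓢(Phase n, ℂ)) : Prop where
  assoc : ∀ f g h, mul (mul f g) h = mul f (mul g h)
  conj_mul : ∀ f g, conjS (mul f g) = mul (conjS g) (conjS f)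
  continuous_left : ∀ f, Continuous fun g => mul f g
  continuous_right : ∀ g, Continuous fun f => mul f g
  integral_mul : ∀ f g,
    ∫ X, mul f g X ∂(phaseMeasure n) = ∫ X, f X * g X ∂(phaseMeasure n)

section Law

variable {n : ℕ} {mul : 𝓢(Phase n, ℂ) →ₗ[ℂ] 𝓢(Phase n, ℂ) →ₗ[ℂ] 𝓢(Phase n, ℂ)}

/-- Left multiplication `L_f : g ↦ f # g`. -/
def HypothesisA.leftMul (hA : HypothesisA mul) (f : 𝓢(Phase n, ℂ)) :
    𝓢(Phase n, ℂ) →L[ℂ] 𝓢(Phase n, ℂ) :=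
  ⟨mul f, hA.continuous_left f⟩

/-- Right multiplication `R_f : g ↦ g # f`. -/
def HypothesisA.rightMul (hA : HypothesisA mul) (f : 𝓢(Phase n, ℂ)) :
    𝓢(Phase n, ℂ) →L[ℂ] 𝓢(Phase n, ℂ) :=
  ⟨mul.flip f, hA.continuous_right f⟩

/-- The product `f # u` of a Schwartz function and a distribution: `⟨f # u, h⟩ = ⟨u, h # f⟩`. -/
def HypothesisA.schwartzMulDist (hA : HypothesisA mul) (f : 𝓢(Phase n, ℂ))
    (u : StrongDual ℂ 𝓢(Phase n, ℂ)) : StrongDual ℂ 𝓢(Phase n, ℂ) :=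
  u.comp (hA.rightMul f)

/-- The product `u # f` of a distribution and a Schwartz function: `⟨u # f, h⟩ = ⟨u, f # h⟩`. -/
def HypothesisA.distMulSchwartz (hA : HypothesisA mul) (u : StrongDual ℂ 𝓢(Phase n, ℂ))
    (f : 𝓢(Phase n, ℂ)) : StrongDual ℂ 𝓢(Phase n, ℂ) :=
  u.comp (hA.leftMul f)

/-- Hypothesis B: `𝓢(Ξ) # 𝓢'(Ξ) # 𝓢(Ξ) ⊆ 𝓢(Ξ)`. -/
def HypothesisB (hA : HypothesisA mul) : Prop :=
  ∀ (f₁ f₂ : 𝓢(Phase n, ℂ)) (u : StrongDual ℂ 𝓢(Phase n, ℂ)),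
    ∃ h : 𝓢(Phase n, ℂ),
      hA.distMulSchwartz (hA.schwartzMulDist f₁ u) f₂ = toDist (phaseMeasure n) h

end Law

/-! ### The maps `R`, `N`, `M` -/

/-- `T` satisfies the formula that defines `R`:
`⟪R(f₁ ⊗ f₂), g₁ ⊗ g₂⟫ = ⟨g₁ # f₁, g₂ # f₂⟩`. -/
def IsMapR {n : ℕ} (mul : 𝓢(Phase n, ℂ) →ₗ[ℂ] 𝓢(Phase n, ℂ) →ₗ[ℂ] 𝓢(Phase n, ℂ))
    (T : 𝓢(Phase n × Phase n, ℂ) →L[ℂ] StrongDual ℂ 𝓢(Phase n × Phase n, ℂ)) : Prop :=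
  ∀ f₁ f₂ g₁ g₂ : 𝓢(Phase n, ℂ),
    T (tensor f₁ f₂) (tensor g₁ g₂) = pair (mul g₁ f₁) (mul g₂ f₂)

/-- `T` satisfies the formula that defines `N`:
`⟪N(f₁ ⊗ f₂), g₁ ⊗ g₂⟫ = ⟨ĝ₁ # f₁, ĝ₂ # f₂⟩`. -/
def IsMapN {n : ℕ} (mul : 𝓢(Phase n, ℂ) →ₗ[ℂ] 𝓢(Phase n, ℂ) →ₗ[ℂ] 𝓢(Phase n, ℂ))
    (T : 𝓢(Phase n × Phase n, ℂ) →L[ℂ] StrongDual ℂ 𝓢(Phase n × Phase n, ℂ)) : Prop :=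
  ∀ f₁ f₂ g₁ g₂ : 𝓢(Phase n, ℂ),
    T (tensor f₁ f₂) (tensor g₁ g₂)
      = pair (mul (symplecticFourier n g₁) f₁) (mul (symplecticFourier n g₂) f₂)

/-- The change of variables `C(X, Y) = (-X, X - Y)` of `Ξ × Ξ`. -/
def changeVar (n : ℕ) : (Phase n × Phase n) ≃L[ℝ] (Phase n × Phase n) :=
  LinearEquiv.toContinuousLinearEquiv
    { toFun := fun P => (-P.1, P.1 - P.2)
      map_add' := by intro P Q; ext <;> simp <;> ring
      map_smul' := by intro c P; ext <;> simp [mul_sub]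
      invFun := fun P => (-P.1, -P.1 - P.2)
      left_inv := by intro P; ext <;> simp
      right_inv := by intro P; ext <;> simp }

@[simp] lemma changeVar_apply {n : ℕ} (P : Phase n × Phase n) :
    changeVar n P = (-P.1, P.1 - P.2) := rfl

/-- `F ↦ F ∘ C` on `𝓢(Ξ × Ξ)`. -/
def compC (n : ℕ) : 𝓢(Phase n × Phase n, ℂ) →L[ℂ] 𝓢(Phase n × Phase n, ℂ) :=
  SchwartzMap.compCLMOfContinuousLinearEquiv ℂ (changeVar n)

/-- `u ↦ u ∘ C` on tempered distributions, `⟪u ∘ C, G⟫ = ⟪u, G ∘ C⁻¹⟫`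
(`C` preserves the measure). -/
def compCDist (n : ℕ) :
    StrongDual ℂ 𝓢(Phase n × Phase n, ℂ) →L[ℂ] StrongDual ℂ 𝓢(Phase n × Phase n, ℂ) :=
  ContinuousLinearMap.precomp ℂ
    (SchwartzMap.compCLMOfContinuousLinearEquiv ℂ (changeVar n).symm)

/-- The modulation mapping `M F = (N F) ∘ C`, that is
`[M(f ⊗ g)](X, Y) = [N(f ⊗ g)](-X, X - Y)`. -/
def mapM {n : ℕ}
    (N : 𝓢(Phase n × Phase n, ℂ) →L[ℂ] StrongDual ℂ 𝓢(Phase n × Phase n, ℂ)) :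
    𝓢(Phase n × Phase n, ℂ) →L[ℂ] StrongDual ℂ 𝓢(Phase n × Phase n, ℂ) :=
  (compCDist n).comp N

/-- The other composition of `N` with the change of variables, `F ↦ N (F ∘ C)`. -/
def mapM' {n : ℕ}
    (N : 𝓢(Phase n × Phase n, ℂ) →L[ℂ] StrongDual ℂ 𝓢(Phase n × Phase n, ℂ)) :
    𝓢(Phase n × Phase n, ℂ) →L[ℂ] StrongDual ℂ 𝓢(Phase n × Phase n, ℂ) :=
  N.comp (compC n)

/-- A continuous linear map `A` of `𝓢(Ξ × Ξ)` extends uniquely to a continuous linear map of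
`𝓢'(Ξ × Ξ)`, for the strong topology and also for the weak topology on `𝓢'(Ξ × Ξ)`. -/
def ExtendsUniquely {n : ℕ}
    (A : 𝓢(Phase n × Phase n, ℂ) →L[ℂ] 𝓢(Phase n × Phase n, ℂ)) : Prop :=
  (∃! B : StrongDual ℂ 𝓢(Phase n × Phase n, ℂ) →L[ℂ] StrongDual ℂ 𝓢(Phase n × Phase n, ℂ),
    ∀ F, B (toDist (doubleMeasure n) F) = toDist (doubleMeasure n) (A F)) ∧
  (∃! B : 𝓢'(Phase n × Phase n, ℂ) →L[ℂ] 𝓢'(Phase n × Phase n, ℂ),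
    ∀ F, B (SchwartzMap.toTemperedDistributionCLM _ ℂ (doubleMeasure n) F)
      = SchwartzMap.toTemperedDistributionCLM _ ℂ (doubleMeasure n) (A F))

/-- `T : 𝓢(Ξ × Ξ) → 𝓢'(Ξ × Ξ)` is in fact a continuous linear map of `𝓢(Ξ × Ξ)` into itself, which
extends uniquely to a continuous linear map of `𝓢'(Ξ × Ξ)`. -/
def RestrictsAndExtends {n : ℕ}
    (T : 𝓢(Phase n × Phase n, ℂ) →L[ℂ] StrongDual ℂ 𝓢(Phase n × Phase n, ℂ)) : Prop :=
  ∃ A : 𝓢(Phase n × Phase n, ℂ) →L[ℂ] 𝓢(Phase n × Phase n, ℂ),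
    (∀ F, T F = toDist (doubleMeasure n) (A F)) ∧ ExtendsUniquely A

end AbstractComposition

end

open AbstractComposition

open Filter Topology

noncomputable section

/-! ### Completeness of the Schwartz space -/

namespace SchwartzMap

section Complete

variable {E F : Type*} [NormedAddCommGroup E] [NormedSpace ℝ E]
  [NormedAddCommGroup F] [NormedSpace ℝ F]

/-! Write τ(f) = ∫ f. Hypothesis A gives ⟨f, g⟩ = τ(f # g), so τ is cyclic, and the form that
defines R is τ(g₁ # f₁ # g₂ # f₂). Everything is read off in coefficients with respect to a Gabor
frame: atoms a_i, dual atoms b_i and weights w_i ≥ 1 with ∑ 1/w_i < ∞, such that f = ∑ ⟨b_i, f⟩ a_i.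
Pairings of a Schwartz function with the atoms decrease rapidly in w_i, while each continuous
seminorm of the atoms grows at most polynomially. Moreover the products a_i ⊗ a_j, b_i ⊗ b_j form
such a frame on Ξ × Ξ, which replaces the kernel theorem: bilinear data on 𝓢(Ξ) extend to 𝓢(Ξ × Ξ),
and tensors span a dense subspace.

In the frame, R(f₁ ⊗ f₂) must be ∑ ⟨a_i, f₁ # a_j # f₂⟩ b_i ⊗ b_j. The heart of the proof is that
these coefficients decrease rapidly jointly in (i, j) (`HypothesisB.rapidlyDecreasing`). For x in ℓ¹
the series u = ∑ x_l w_l^N ⟨a_l, ·⟩ is a tempered distribution, so f₁ # u # f₂ is a Schwartz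
function by Hypothesis B and its coefficients, multiplied by w_k^N, are bounded in k.
Banach–Steinhaus on ℓ¹ makes the bound uniform in l as well. Uniform boundedness on 𝓢, which rests
on its completeness, supplies the continuity in f₁ and f₂ (`exists_seminorm_bound_bilin`,
`IsTensorFrame.exists_clm`), and R becomes a continuous map A of 𝓢(Ξ × Ξ).

Cyclicity of τ shows that the transpose of A is A composed with the flip F(X, Y) ↦ F(Y, X), so it
preserves 𝓢(Ξ × Ξ) too. A map with such a transpose A' extends to distributions by u ↦ u ∘ A',
uniquely because frame expansions converge in 𝓢' (`IsTensorFrame.extendsUniquely`). Finally N, M and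
F ↦ N(F ∘ C) arise from A by composition with Fourier transforms and the measure-preserving map C,
all of which have transposes of the same kind.

The frame itself comes from a smooth window whose squared translates along the lattice ℤ/4 sum to
one, combined with Fourier series in unit cubes (`isSchwartzFrame_lattice`). -/

lemma cauchySeq_iteratedFDeriv {u : ℕ → 𝓢(E, F)} (hu : CauchySeq u) (k n : ℕ) {ε : ℝ}
    (hε : 0 < ε) :
    ∃ N, ∀ a ≥ N, ∀ b ≥ N, ∀ x, ‖x‖ ^ k *
      ‖iteratedFDeriv ℝ n (u a) x - iteratedFDeriv ℝ n (u b) x‖ ≤ ε := by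
  have hc : Continuous (SchwartzMap.seminorm ℝ k n : 𝓢(E, F) → ℝ) :=
    (schwartz_withSeminorms ℝ E F).continuous_seminorm (k, n)
  have hlim : Tendsto (fun p : ℕ × ℕ => SchwartzMap.seminorm ℝ k n (u p.1 - u p.2))
      (atTop ×ˢ atTop) (𝓝 0) := by
    have h0 : Tendsto (fun p : ℕ × ℕ => u p.2 - u p.1) (atTop ×ˢ atTop) (𝓝 0) := by
      have := hu.tendsto_uniformity
      rw [uniformity_eq_comap_nhds_zero, tendsto_comap_iff] at this
      simpa [prod_atTop_atTop_eq] using! this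
    have h1 := (hc.tendsto 0).comp h0
    rw [map_zero] at h1
    refine h1.congr fun p => ?_
    exact map_sub_rev _ _ _
  obtain ⟨N, hN⟩ := eventually_atTop.1 (prod_atTop_atTop_eq (α := ℕ) (β := ℕ) ▸
    hlim.eventually (gt_mem_nhds hε))
  refine ⟨max N.1 N.2, fun a ha b hb x => ?_⟩
  have h1 := hN (a, b) ⟨(le_max_left _ _).trans ha, (le_max_right _ _).trans hb⟩
  have h2 := le_seminorm ℝ k n (u a - u b) x
  have h3 : iteratedFDeriv ℝ n (u a - u b : 𝓢(E, F)) x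
      = iteratedFDeriv ℝ n (u a) x - iteratedFDeriv ℝ n (u b) x := by
    have := iteratedFDeriv_sub_apply (𝕜 := ℝ) (i := n) (x := x)
      ((u a).smooth n).contDiffAt ((u b).smooth n).contDiffAt
    simpa using! this
  rw [h3] at h2
  exact h2.trans h1.le

/-- All derivatives of a Cauchy sequence converge uniformly, so their limits form a Taylor series of
the limit function. The weighted estimates pass to the limit and give both decay and convergence. -/
instance instCompleteSpace [CompleteSpace F] : CompleteSpace 𝓢(E, F) := by
  have : (uniformity 𝓢(E, F)).IsCountablyGenerated :=
    IsUniformAddGroup.uniformity_countably_generated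
  refine UniformSpace.complete_of_cauchySeq_tendsto fun u hu => ?_
  have hcau := cauchySeq_iteratedFDeriv hu
  have hex : ∀ (n : ℕ) (x : E), ∃ L, Tendsto (fun a => iteratedFDeriv ℝ n (u a) x) atTop (𝓝 L) := by
    intro n x
    refine cauchySeq_tendsto_of_complete (Metric.cauchySeq_iff'.2 fun ε hε => ?_)
    obtain ⟨N, hN⟩ := hcau 0 n (half_pos hε)
    refine ⟨N, fun a ha => ?_⟩
    have := hN a ha N le_rfl x
    rw [pow_zero, one_mul, ← dist_eq_norm] at this
    linarith
  choose G hG using hex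
  have hbound : ∀ (k n : ℕ) (ε : ℝ), 0 < ε → ∃ N, ∀ a ≥ N, ∀ x,
      ‖x‖ ^ k * ‖iteratedFDeriv ℝ n (u a) x - G n x‖ ≤ ε := by
    intro k n ε hε
    obtain ⟨N, hN⟩ := hcau k n hε
    refine ⟨N, fun a ha x => ?_⟩
    refine le_of_tendsto (((tendsto_const_nhds.sub (hG n x)).norm).const_mul _)
      (eventually_atTop.2 ⟨N, fun b hb => hN a ha b hb x⟩)
  have hunif : ∀ n, TendstoUniformly (fun a x => iteratedFDeriv ℝ n (u a) x) (G n) atTop := by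
    intro n
    refine Metric.tendstoUniformly_iff.2 fun ε hε => ?_
    obtain ⟨N, hN⟩ := hbound 0 n _ (half_pos hε)
    refine eventually_atTop.2 ⟨N, fun a ha x => ?_⟩
    have := hN a ha x
    rw [pow_zero, one_mul, ← dist_eq_norm, dist_comm] at this
    linarith
  have htaylor : HasFTaylorSeriesUpTo ((⊤ : ℕ∞) : WithTop ℕ∞) (fun x => (G 0 x).curry0)
      (fun x n => G n x) := by
    refine ⟨fun x => rfl, fun m _ x => ?_, fun m _ => ?_⟩
    · have h1 : TendstoUniformly
          (fun a x => (iteratedFDeriv ℝ (m + 1) (u a) x).curryLeft)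
          (fun x => (G (m + 1) x).curryLeft) atTop :=
        (continuousMultilinearCurryLeftEquiv ℝ (fun _ : Fin (m + 1) => E)
          F).isometry.uniformContinuous.comp_tendstoUniformly (hunif (m + 1))
      refine hasFDerivAt_of_tendstoUniformly h1 (fun a y => ?_) (fun y => hG m y) x
      exact ((u a).smooth ⊤).ftaylorSeries.fderiv m (by exact_mod_cast WithTop.coe_lt_top m) y
    · refine (hunif m).continuous (Eventually.of_forall fun a => ?_).frequently
      exact ((u a).smooth m).continuous_iteratedFDeriv le_rfl
  have hiter : ∀ n x, iteratedFDeriv ℝ n (fun x => (G 0 x).curry0) x = G n x := fun n x =>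
    (htaylor.eq_iteratedFDeriv (by exact_mod_cast le_top) x).symm
  let f : 𝓢(E, F) :=
    { toFun := fun x => (G 0 x).curry0
      smooth' := htaylor.contDiff
      decay' := by
        intro k n
        obtain ⟨N, hN⟩ := hbound k n 1 one_pos
        refine ⟨1 + SchwartzMap.seminorm ℝ k n (u N), fun x => ?_⟩
        rw [hiter]
        have h1 := hN N le_rfl x
        have h2 := le_seminorm ℝ k n (u N) x
        have h3 : ‖G n x‖ ≤
            ‖iteratedFDeriv ℝ n (u N) x - G n x‖ + ‖iteratedFDeriv ℝ n (u N) x‖ := by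
          have := norm_sub_le (iteratedFDeriv ℝ n (u N) x) (iteratedFDeriv ℝ n (u N) x - G n x)
          rw [sub_sub_cancel] at this
          linarith
        calc ‖x‖ ^ k * ‖G n x‖ ≤ ‖x‖ ^ k * (‖iteratedFDeriv ℝ n (u N) x - G n x‖
              + ‖iteratedFDeriv ℝ n (u N) x‖) := by gcongr
          _ ≤ _ := by rw [mul_add]; linarith }
  refine ⟨f, ((schwartz_withSeminorms ℝ E F).tendsto_nhds_atTop _ _).2 fun i ε hε => ?_⟩
  obtain ⟨N, hN⟩ := hbound i.1 i.2 _ (half_pos hε)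
  refine ⟨N, fun a ha => lt_of_le_of_lt ?_ (half_lt_self hε)⟩
  refine seminorm_le_bound ℝ i.1 i.2 _ (half_pos hε).le fun x => ?_
  have h3 : iteratedFDeriv ℝ i.2 (u a - f : 𝓢(E, F)) x
      = iteratedFDeriv ℝ i.2 (u a) x - iteratedFDeriv ℝ i.2 f x := by
    have := iteratedFDeriv_sub_apply (𝕜 := ℝ) (i := i.2) (x := x)
      ((u a).smooth i.2).contDiffAt (f.smooth i.2).contDiffAt
    simpa using! this
  rw [h3]
  have h4 : iteratedFDeriv ℝ i.2 f x = G i.2 x := hiter _ _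
  rw [h4]
  exact hN a ha x

/-- Completeness and a countable uniformity give the Baire property, on which every uniform
boundedness argument on 𝓢 below rests. -/
instance instBaireSpace [CompleteSpace F] : BaireSpace 𝓢(E, F) := by
  have : (uniformity 𝓢(E, F)).IsCountablyGenerated :=
    IsUniformAddGroup.uniformity_countably_generated
  infer_instance

instance instT2Space : T2Space 𝓢(E, F) := by
  have : T1Space 𝓢(E, F) := (schwartz_withSeminorms ℝ E F).T1_of_separating fun f hf => by
    refine ⟨(0, 0), fun h => hf ?_⟩
    ext x
    have := norm_le_seminorm ℝ f x
    rw [show SchwartzMap.seminorm ℝ 0 0 f = 0 from h] at this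
    simpa using this
  infer_instance

end Complete

end SchwartzMap

/-! ### Continuous seminorms, summability and uniform boundedness -/

namespace SchwartzMap

section Bounds

variable {D E : Type*} [NormedAddCommGroup D] [NormedSpace ℝ D]
  [NormedAddCommGroup E] [NormedSpace ℝ E]

variable (E) in
/-- An increasing sequence of seminorms that defines the topology of `𝓢(E, ℂ)`. -/
def supSeminorm (m : ℕ) : Seminorm ℂ 𝓢(E, ℂ) :=
  (Finset.Iic (m, m)).sup fun i : ℕ × ℕ => SchwartzMap.seminorm ℂ i.1 i.2

lemma continuous_supSeminorm (m : ℕ) : Continuous (supSeminorm E m) := by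
  have h : supSeminorm E m = (Finset.Iic (m, m)).sup (schwartzSeminormFamily ℂ E ℂ) := rfl
  rw [h]
  refine Finset.sup_induction (p := fun q : Seminorm ℂ 𝓢(E, ℂ) => Continuous q) ?_ ?_ ?_
  · exact continuous_const
  · intro p hp q hq
    exact hp.sup hq
  · intro i _
    exact (schwartz_withSeminorms ℂ E ℂ).continuous_seminorm i

lemma supSeminorm_mono {m m' : ℕ} (h : m ≤ m') : supSeminorm E m ≤ supSeminorm E m' :=
  Finset.sup_mono (Finset.Iic_subset_Iic.2 ⟨h, h⟩)

lemma exists_le_supSeminorm (q : Seminorm ℂ 𝓢(E, ℂ)) (hq : Continuous q) :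
    ∃ (C : ℝ) (m : ℕ), 0 ≤ C ∧ ∀ f, q f ≤ C * supSeminorm E m f := by
  obtain ⟨s, C, -, hC⟩ := Seminorm.bound_of_continuous (schwartz_withSeminorms ℂ E ℂ) q hq
  refine ⟨C, s.sup fun i => max i.1 i.2, C.2, fun f => (hC f).trans ?_⟩
  refine mul_le_mul_of_nonneg_left (Seminorm.le_def.1 (?_ : s.sup _ ≤ _) f) C.2
  refine Finset.sup_mono fun i hi => Finset.mem_Iic.2 ⟨?_, ?_⟩
  · exact (le_max_left _ _).trans (Finset.le_sup (f := fun i : ℕ × ℕ => max i.1 i.2) hi)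
  · exact (le_max_right _ _).trans (Finset.le_sup (f := fun i : ℕ × ℕ => max i.1 i.2) hi)

/-- By completeness it suffices that finite partial sums far out are small, and each seminorm of
such a sum is at most a tail of the given convergent series. -/
lemma summable_of_summable_seminorm {ι : Type*} {f : ι → 𝓢(E, ℂ)}
    (h : ∀ q : Seminorm ℂ 𝓢(E, ℂ), Continuous q → Summable fun i => q (f i)) : Summable f := by
  refine summable_iff_vanishing.2 fun V hV => ?_
  obtain ⟨⟨s, r⟩, hr, hsr⟩ := (schwartz_withSeminorms ℂ E ℂ).hasBasis_zero_ball.mem_iff.1 hV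
  have hq : Continuous (s.sup (schwartzSeminormFamily ℂ E ℂ) : Seminorm ℂ 𝓢(E, ℂ)) := by
    refine Finset.sup_induction (p := fun q : Seminorm ℂ 𝓢(E, ℂ) => Continuous q) ?_ ?_ ?_
    · exact continuous_const
    · exact fun p hp q hq => hp.sup hq
    · exact fun i _ => (schwartz_withSeminorms ℂ E ℂ).continuous_seminorm i
  obtain ⟨t, ht⟩ := summable_iff_vanishing.1 (h _ hq) (Metric.ball 0 r) (Metric.ball_mem_nhds 0 hr)
  refine ⟨t, fun t' ht' => hsr ?_⟩
  rw [Seminorm.mem_ball_zero]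
  have h1 := ht t' ht'
  rw [mem_ball_zero_iff, Real.norm_eq_abs] at h1
  exact ((Finset.le_sum_of_subadditive _ (map_zero _).le (map_add_le_add _) _ _).trans
    (le_abs_self _)).trans_lt h1

/-- Uniform boundedness principle for functionals on the Schwartz space. -/
lemma exists_seminorm_bound {κ : Type*} (u : κ → StrongDual ℂ 𝓢(E, ℂ))
    (h : ∀ f, ∃ C, ∀ i, ‖u i f‖ ≤ C) :
    ∃ q : Seminorm ℂ 𝓢(E, ℂ), Continuous q ∧ ∀ i f, ‖u i f‖ ≤ q f := by
  let p : κ → Seminorm ℂ 𝓢(E, ℂ) := fun i => (normSeminorm ℂ ℂ).comp (u i).toLinearMap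
  have hb : BddAbove (Set.range p) := by
    rw [Seminorm.bddAbove_range_iff]
    intro f
    obtain ⟨C, hC⟩ := h f
    exact ⟨C, by rintro _ ⟨i, rfl⟩; exact hC i⟩
  -- A Baire locally convex space is barrelled, so a pointwise finite supremum of continuous
  -- seminorms is continuous.
  have hcont : Continuous (⨆ i, p i : Seminorm ℂ 𝓢(E, ℂ)) := by
    rw [Seminorm.coe_iSup_eq hb]
    exact Seminorm.continuous_iSup p (fun i => (u i).continuous.norm) hb
  refine ⟨⨆ i, p i, hcont, fun i f => ?_⟩
  rw [Seminorm.iSup_apply hb]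
  exact le_ciSup (f := fun i => p i f) (Seminorm.bddAbove_range_iff.1 hb f) i

/-- A diagonal criterion: controlling the m-th term in the m-th seminorm alone is enough, because
these seminorms increase and dominate every continuous one. -/
lemma tendsto_of_supSeminorm {f : ℕ → 𝓢(E, ℂ)}
    (hf : ∀ m, supSeminorm E m (f m) ≤ ((m : ℝ) + 1)⁻¹) (q : Seminorm ℂ 𝓢(E, ℂ))
    (hq : Continuous q) : Tendsto (fun m => q (f m)) atTop (𝓝 0) := by
  obtain ⟨C, m₀, hC, h⟩ := exists_le_supSeminorm q hq
  have h0 : Tendsto (fun m : ℕ => C * ((m : ℝ) + 1)⁻¹) atTop (𝓝 0) := by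
    have := (tendsto_one_div_add_atTop_nhds_zero_nat (𝕜 := ℝ)).const_mul C
    simpa using this
  refine squeeze_zero' (Eventually.of_forall fun m => apply_nonneg _ _) ?_ h0
  filter_upwards [eventually_ge_atTop m₀] with m hm
  refine (h _).trans (mul_le_mul_of_nonneg_left ?_ hC)
  exact (Seminorm.le_def.1 (supSeminorm_mono hm) _).trans (hf m)

/-- Uniform boundedness principle for separately continuous bilinear forms on Schwartz spaces. -/
lemma exists_seminorm_bound_bilin {κ : Type*} (β : κ → 𝓢(D, ℂ) →ₗ[ℂ] 𝓢(E, ℂ) →ₗ[ℂ] ℂ)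
    (hr : ∀ i f, Continuous (β i f)) (hl : ∀ i g, Continuous fun f => β i f g)
    (h : ∀ f g, ∃ C, ∀ i, ‖β i f g‖ ≤ C) :
    ∃ (p : Seminorm ℂ 𝓢(D, ℂ)) (q : Seminorm ℂ 𝓢(E, ℂ)), Continuous p ∧ Continuous q ∧
      ∀ i f g, ‖β i f g‖ ≤ p f * q g := by
  -- If no m works, the witnesses divided by m + 1 form null sequences in both variables along which
  -- the forms stay at least 1 in modulus. Uniform boundedness, applied first in f for fixed g₀ and
  -- then in g, excludes this.
  have key : ∃ m : ℕ, ∀ i f g, supSeminorm D m f ≤ 1 → supSeminorm E m g ≤ 1 →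
      ‖β i f g‖ ≤ ((m : ℝ) + 1) ^ 2 := by
    by_contra! hcon
    choose i f g hf hg hβ using hcon
    let c : ℕ → ℂ := fun m => (((m : ℝ) + 1)⁻¹ : ℝ)
    have hc : ∀ m, ‖c m‖ = ((m : ℝ) + 1)⁻¹ := fun m => by
      rw [Complex.norm_real, Real.norm_eq_abs, abs_of_pos (by positivity)]
    have hf' : ∀ m, supSeminorm D m (c m • f m) ≤ ((m : ℝ) + 1)⁻¹ := fun m => by
      rw [map_smul_eq_mul, hc]
      exact mul_le_of_le_one_right (by positivity) (hf m)
    have hg' : ∀ m, supSeminorm E m (c m • g m) ≤ ((m : ℝ) + 1)⁻¹ := fun m => by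
      rw [map_smul_eq_mul, hc]
      exact mul_le_of_le_one_right (by positivity) (hg m)
    have hβ' : ∀ m, 1 ≤ ‖β (i m) (c m • f m) (c m • g m)‖ := fun m => by
      rw [map_smul, map_smul, LinearMap.smul_apply, norm_smul, norm_smul, hc, ← mul_assoc]
      have := (hβ m).le
      have h2 : (0 : ℝ) < (m : ℝ) + 1 := by positivity
      calc (1 : ℝ) = ((m : ℝ) + 1)⁻¹ * ((m : ℝ) + 1)⁻¹ * ((m : ℝ) + 1) ^ 2 := by field_simp
        _ ≤ _ := by gcongr
    let u : ℕ → StrongDual ℂ 𝓢(E, ℂ) := fun m => ⟨β (i m) (c m • f m), hr _ _⟩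
    obtain ⟨q, hq, hbd⟩ := exists_seminorm_bound u (fun g₀ => by
      obtain ⟨p, hp, hpb⟩ := exists_seminorm_bound
        (fun j => (⟨(β j).flip g₀, hl j g₀⟩ : StrongDual ℂ 𝓢(D, ℂ)))
        (fun f₀ => h f₀ g₀)
      obtain ⟨C, hC⟩ := (tendsto_of_supSeminorm hf' p hp).bddAbove_range
      exact ⟨C, fun m => (hpb (i m) _).trans (hC ⟨m, rfl⟩)⟩)
    have h1 := tendsto_of_supSeminorm hg' q hq
    obtain ⟨m, hm⟩ := (h1.eventually (gt_mem_nhds one_pos)).exists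
    exact absurd ((hβ' m).trans (hbd m _)) (not_le.2 hm)
  obtain ⟨m, hm⟩ := key
  refine ⟨(((m : ℝ≥0) + 1) ^ 2) • supSeminorm D m, supSeminorm E m,
    (continuous_supSeminorm m).const_smul (((m : ℝ≥0) + 1) ^ 2), continuous_supSeminorm m,
    fun i f g => ?_⟩
  rw [smul_apply, NNReal.smul_def, smul_eq_mul]
  push_cast
  -- The shift by ε permits normalising f and g even where the seminorms vanish; it is removed by
  -- letting ε tend to 0.
  have hε : ∀ ε : ℝ, 0 < ε → ‖β i f g‖ ≤
      ((m : ℝ) + 1) ^ 2 * (supSeminorm D m f + ε) * (supSeminorm E m g + ε) := by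
    intro ε hε
    have hP : 0 < supSeminorm D m f + ε := add_pos_of_nonneg_of_pos (apply_nonneg _ _) hε
    have hQ : 0 < supSeminorm E m g + ε := add_pos_of_nonneg_of_pos (apply_nonneg _ _) hε
    have := hm i ((((supSeminorm D m f + ε)⁻¹ : ℝ) : ℂ) • f)
      ((((supSeminorm E m g + ε)⁻¹ : ℝ) : ℂ) • g)
      (by
        rw [map_smul_eq_mul, Complex.norm_real, Real.norm_eq_abs, abs_of_pos (by positivity),
          inv_mul_le_iff₀ hP]
        linarith)
      (by
        rw [map_smul_eq_mul, Complex.norm_real, Real.norm_eq_abs, abs_of_pos (by positivity),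
          inv_mul_le_iff₀ hQ]
        linarith)
    rw [map_smul, map_smul, LinearMap.smul_apply, norm_smul, norm_smul, Complex.norm_real,
      Complex.norm_real, Real.norm_eq_abs, Real.norm_eq_abs, abs_of_pos (inv_pos.2 hP),
      abs_of_pos (inv_pos.2 hQ), inv_mul_le_iff₀ hQ, inv_mul_le_iff₀ hP] at this
    linarith
  have hlim : Tendsto (fun ε : ℝ =>
      ((m : ℝ) + 1) ^ 2 * (supSeminorm D m f + ε) * (supSeminorm E m g + ε)) (𝓝[>] 0)
      (𝓝 (((m : ℝ) + 1) ^ 2 * (supSeminorm D m f + 0) * (supSeminorm E m g + 0))) := by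
    refine Tendsto.mono_left ?_ nhdsWithin_le_nhds
    exact Continuous.tendsto (by fun_prop) 0
  rw [add_zero, add_zero] at hlim
  exact ge_of_tendsto hlim (eventually_nhdsWithin_of_forall fun ε hε' => hε ε hε')

end Bounds

end SchwartzMap

namespace AbstractComposition

/-! ### Weighted families and frames -/

section Frames

variable {ι κ D E : Type*} [NormedAddCommGroup D] [NormedSpace ℝ D]
  [NormedAddCommGroup E] [NormedSpace ℝ E]

/-- Every continuous seminorm of `a i` is bounded by a power of the weight `w i`. -/
def PolyBounded (w : ι → ℝ) (a : ι → 𝓢(E, ℂ)) : Prop :=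
  ∀ q : Seminorm ℂ 𝓢(E, ℂ), Continuous q → ∃ (C : ℝ) (M : ℕ), 0 ≤ C ∧ ∀ i, q (a i) ≤ C * w i ^ M

/-- The numbers `c i` decrease faster than any power of the weight `w i`. -/
def RapidlyDecreasing (w : ι → ℝ) (c : ι → ℂ) : Prop :=
  ∀ N : ℕ, ∃ C : ℝ, ∀ i, w i ^ N * ‖c i‖ ≤ C

lemma PolyBounded.comp_clm {w : ι → ℝ} {a : ι → 𝓢(D, ℂ)} (h : PolyBounded w a)
    (T : 𝓢(D, ℂ) →L[ℂ] 𝓢(E, ℂ)) : PolyBounded w fun i => T (a i) := by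
  intro q hq
  exact h (q.comp T.toLinearMap) (hq.comp T.continuous)

/-- A rapidly decreasing family of functionals, tested against coefficients of at most polynomial
growth, is dominated by a single continuous seminorm times the inverse weights. -/
lemma exists_dominating_seminorm {w : ι → ℝ} (hw : ∀ i, 1 ≤ w i)
    {α : ι → StrongDual ℂ 𝓢(D, ℂ)} (hα : ∀ F, RapidlyDecreasing w fun i => α i F)
    {C : ℝ} (hC : 0 ≤ C) (M : ℕ) :
    ∃ p : Seminorm ℂ 𝓢(D, ℂ), Continuous p ∧
      ∀ i F, ‖α i F‖ * (C * w i ^ M) ≤ (w i)⁻¹ * p F := by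
  -- The exponent M + 1 rather than M leaves a spare factor of the weight, whose inverse is
  -- summable.
  obtain ⟨p, hp, hb⟩ := SchwartzMap.exists_seminorm_bound
    (fun i => (((C * w i ^ (M + 1) : ℝ) : ℂ)) • α i) (fun F => by
      obtain ⟨K, hK⟩ := hα F (M + 1)
      refine ⟨C * K, fun i => ?_⟩
      have h0 : 0 ≤ w i := zero_le_one.trans (hw i)
      have h1 : 0 ≤ C * w i ^ (M + 1) := by positivity
      rw [smul_apply, norm_smul, Complex.norm_real, Real.norm_eq_abs, abs_of_nonneg h1,
        mul_assoc]
      exact mul_le_mul_of_nonneg_left (hK i) hC)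
  refine ⟨p, hp, fun i F => ?_⟩
  have h0 : 0 < w i := zero_lt_one.trans_le (hw i)
  have h1 : 0 ≤ C * w i ^ (M + 1) := by positivity
  have h2 := hb i F
  rw [smul_apply, norm_smul, Complex.norm_real, Real.norm_eq_abs, abs_of_nonneg h1] at h2
  rw [← div_eq_inv_mul, le_div_iff₀ h0]
  calc ‖α i F‖ * (C * w i ^ M) * w i = C * w i ^ (M + 1) * ‖α i F‖ := by ring
    _ ≤ p F := h2

/-- Synthesis of a continuous linear map from a rapidly decreasing family of functionals and a
family of Schwartz functions of at most polynomial growth. -/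
lemma exists_clm_hasSum {w : ι → ℝ} (hw : ∀ i, 1 ≤ w i) (hs : Summable fun i => (w i)⁻¹)
    {α : ι → StrongDual ℂ 𝓢(D, ℂ)} (hα : ∀ F, RapidlyDecreasing w fun i => α i F)
    {B : ι → 𝓢(E, ℂ)} (hB : PolyBounded w B) :
    ∃ T : 𝓢(D, ℂ) →L[ℂ] 𝓢(E, ℂ), ∀ F, HasSum (fun i => α i F • B i) (T F) := by
  have key : ∀ q : Seminorm ℂ 𝓢(E, ℂ), Continuous q → ∃ p : Seminorm ℂ 𝓢(D, ℂ), Continuous p ∧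
      ∀ i F, q (α i F • B i) ≤ (w i)⁻¹ * p F := by
    intro q hq
    obtain ⟨C, M, hC, hCM⟩ := hB q hq
    obtain ⟨p, hp, h⟩ := exists_dominating_seminorm hw hα hC M
    refine ⟨p, hp, fun i F => (h i F).trans' ?_⟩
    rw [map_smul_eq_mul]
    exact mul_le_mul_of_nonneg_left (hCM i) (norm_nonneg _)
  have hsum : ∀ F, Summable fun i => α i F • B i := by
    intro F
    refine SchwartzMap.summable_of_summable_seminorm fun q hq => ?_
    obtain ⟨p, -, h⟩ := key q hq
    exact Summable.of_nonneg_of_le (fun i => apply_nonneg _ _) (fun i => h i F)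
      (hs.mul_right (p F))
  let T : 𝓢(D, ℂ) →ₗ[ℂ] 𝓢(E, ℂ) :=
    { toFun := fun F => ∑' i, α i F • B i
      map_add' := fun F G => by
        simp only [map_add, add_smul]
        exact (hsum F).tsum_add (hsum G)
      map_smul' := fun c F => by
        simp only [map_smul, smul_eq_mul, mul_smul, RingHom.id_apply]
        exact (hsum F).tsum_const_smul c }
  have hT : ∀ F, HasSum (fun i => α i F • B i) (T F) := fun F => (hsum F).hasSum
  refine ⟨⟨T, ?_⟩, hT⟩
  refine (schwartz_withSeminorms ℂ E ℂ).continuous_of_continuous_comp T fun k => ?_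
  obtain ⟨p, hp, h⟩ := key _ ((schwartz_withSeminorms ℂ E ℂ).continuous_seminorm k)
  set S : ℝ := ∑' i, (w i)⁻¹ with hS
  have hS0 : 0 ≤ S := tsum_nonneg fun i => inv_nonneg.2 (zero_le_one.trans (hw i))
  refine Seminorm.continuous_of_le (q := S.toNNReal • p) (hp.const_smul S.toNNReal)
    (Seminorm.le_def.2 fun F => ?_)
  rw [smul_apply, NNReal.smul_def, smul_eq_mul, Real.coe_toNNReal _ hS0]
  refine le_of_tendsto
    ((((schwartz_withSeminorms ℂ E ℂ).continuous_seminorm k).tendsto _).comp (hT F))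
    (Eventually.of_forall fun s => ?_)
  refine (Finset.le_sum_of_subadditive _ (map_zero _).le (map_add_le_add _) _ _).trans ?_
  refine (Finset.sum_le_sum fun i _ => h i F).trans ?_
  rw [← Finset.sum_mul]
  exact mul_le_mul_of_nonneg_right
    (hs.sum_le_tsum _ fun i _ => inv_nonneg.2 (zero_le_one.trans (hw i))) (apply_nonneg _ _)

/-- A series of functionals dominated by a continuous seminorm converges to a functional. -/
lemma exists_functional_of_dominated {s : ι → ℝ} (hs : Summable s) (hs0 : ∀ i, 0 ≤ s i)
    {α : ι → StrongDual ℂ 𝓢(D, ℂ)} {p : Seminorm ℂ 𝓢(D, ℂ)} (hp : Continuous p)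
    (h : ∀ i F, ‖α i F‖ ≤ s i * p F) :
    ∃ u : StrongDual ℂ 𝓢(D, ℂ), (∀ F, HasSum (fun i => α i F) (u F)) ∧
      ∀ F, ‖u F‖ ≤ (∑' i, s i) * p F := by
  have hsum : ∀ F, Summable fun i => α i F := fun F =>
    Summable.of_norm_bounded (hs.mul_right (p F)) fun i => h i F
  let T : 𝓢(D, ℂ) →ₗ[ℂ] ℂ :=
    { toFun := fun F => ∑' i, α i F
      map_add' := fun F G => by
        simp only [map_add]
        exact (hsum F).tsum_add (hsum G)
      map_smul' := fun c' F => by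
        simp only [map_smul, smul_eq_mul, RingHom.id_apply]
        exact (hsum F).tsum_mul_left c' }
  have hbd : ∀ F, ‖T F‖ ≤ (∑' i, s i) * p F := fun F => by
    rw [← tsum_mul_right]
    exact tsum_of_norm_bounded (hs.mul_right (p F)).hasSum fun i => h i F
  have hcont : Continuous T := by
    refine (norm_withSeminorms ℂ ℂ).continuous_of_continuous_comp T fun _ => ?_
    refine Seminorm.continuous_of_le (q := (∑' i, s i).toNNReal • p) (hp.const_smul _)
      (Seminorm.le_def.2 fun F => ?_)
    rw [smul_apply, NNReal.smul_def, smul_eq_mul, Real.coe_toNNReal _ (tsum_nonneg hs0)]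
    exact hbd F
  exact ⟨⟨T, hcont⟩, fun F => (hsum F).hasSum, hbd⟩

/-- Synthesis of functionals, uniformly in a parameter. -/
lemma exists_functionals_hasSum {w : ι → ℝ} (hw : ∀ i, 1 ≤ w i) (hs : Summable fun i => (w i)⁻¹)
    {α : ι → StrongDual ℂ 𝓢(D, ℂ)} (hα : ∀ F, RapidlyDecreasing w fun i => α i F)
    {c : κ → ι → ℂ} {C : ℝ} (hC : 0 ≤ C) {M : ℕ} (hc : ∀ k i, ‖c k i‖ ≤ C * w i ^ M) :
    ∃ u : κ → StrongDual ℂ 𝓢(D, ℂ), (∀ k F, HasSum (fun i => α i F * c k i) (u k F)) ∧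
      ∀ F, ∃ K, ∀ k, ‖u k F‖ ≤ K := by
  obtain ⟨p, hp, h⟩ := exists_dominating_seminorm hw hα hC M
  choose u hu hb using fun k => exists_functional_of_dominated hs
    (fun i => inv_nonneg.2 (zero_le_one.trans (hw i))) (α := fun i => c k i • α i) hp
    (fun i F => by
      refine (h i F).trans' ?_
      rw [smul_apply, norm_smul, mul_comm]
      exact mul_le_mul_of_nonneg_left (hc k i) (norm_nonneg _))
  refine ⟨u, fun k F => (hu k F).congr_fun fun i => ?_, fun F => ⟨_, fun k => hb k F⟩⟩
  rw [smul_apply, smul_eq_mul, mul_comm]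

lemma eventually_nhds_zero_strongDual {V : Set (StrongDual ℂ 𝓢(E, ℂ))} (hV : V ∈ 𝓝 0) :
    ∃ (S : Set 𝓢(E, ℂ)) (r : ℝ), Bornology.IsVonNBounded ℂ S ∧ 0 < r ∧
      ∀ u : StrongDual ℂ 𝓢(E, ℂ), (∀ f ∈ S, ‖u f‖ < r) → u ∈ V := by
  obtain ⟨⟨S, r⟩, ⟨hS, hr⟩, h⟩ := (ContinuousLinearMap.hasBasis_nhds_zero_of_basis
    (σ := RingHom.id ℂ) (E := 𝓢(E, ℂ)) (Metric.nhds_basis_ball (x := (0 : ℂ)))).mem_iff.1 hV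
  refine ⟨S, r, hS, hr, fun u hu => h fun f hf => ?_⟩
  rw [mem_ball_zero_iff]
  exact hu f hf

lemma exists_bound_of_isVonNBounded {S : Set 𝓢(E, ℂ)} (hS : Bornology.IsVonNBounded ℂ S)
    (p : Seminorm ℂ 𝓢(E, ℂ)) (hp : Continuous p) : ∃ K, 0 < K ∧ ∀ f ∈ S, p f ≤ K := by
  obtain ⟨C, m, hC, h⟩ := SchwartzMap.exists_le_supSeminorm p hp
  obtain ⟨r, hr, hr'⟩ := (schwartz_withSeminorms ℂ E ℂ).isVonNBounded_iff_finset_seminorm_bounded.1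
    hS (Finset.Iic (m, m))
  refine ⟨C * r + 1, by positivity, fun f hf => (h f).trans ?_⟩
  have : SchwartzMap.supSeminorm E m f ≤ r := (hr' f hf).le
  nlinarith

/-! ### Frames of Schwartz functions and the expansion of tempered distributions. -/

variable [MeasurableSpace E] [BorelSpace E] [SecondCountableTopology E]

/-- A discrete frame of Schwartz functions with atoms `a i` and dual atoms `b i`. -/
structure IsSchwartzFrame (μ : Measure E) [μ.HasTemperateGrowth] (w : ι → ℝ)
    (a b : ι → 𝓢(E, ℂ)) : Prop where
  one_le : ∀ i, 1 ≤ w i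
  summable_inv : Summable fun i => (w i)⁻¹
  poly_atom : PolyBounded w a
  poly_dual : PolyBounded w b
  rapid_atom : ∀ f, RapidlyDecreasing w fun i => toDist μ (a i) f
  rapid_dual : ∀ f, RapidlyDecreasing w fun i => toDist μ (b i) f
  expand : ∀ f, HasSum (fun i => toDist μ (b i) f • a i) f

variable {μ : Measure E} [μ.HasTemperateGrowth] {w : ι → ℝ} {a b : ι → 𝓢(E, ℂ)}

lemma toDist_symm (F G : 𝓢(E, ℂ)) : toDist μ F G = toDist μ G F := by
  rw [toDist_apply, toDist_apply]
  exact integral_congr_ae (Eventually.of_forall fun x => mul_comm _ _)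

lemma toDist_add (F G : 𝓢(E, ℂ)) : toDist μ (F + G) = toDist μ F + toDist μ G := by
  ext H
  rw [add_apply, toDist_symm, map_add, toDist_symm, toDist_symm G]

lemma toDist_smul (c : ℂ) (F : 𝓢(E, ℂ)) : toDist μ (c • F) = c • toDist μ F := by
  ext H
  rw [smul_apply, toDist_symm, map_smul, toDist_symm]

/-- The frame expansion of a tempered distribution converges strongly. -/
lemma IsSchwartzFrame.hasSum_strongDual (h : IsSchwartzFrame μ w a b)
    (u : StrongDual ℂ 𝓢(E, ℂ)) : HasSum (fun i => u (a i) • toDist μ (b i)) u := by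
  have hsum : Summable fun i => u (a i) • toDist μ (b i) := by
    obtain ⟨C, M, hC, hCM⟩ := h.poly_atom ((normSeminorm ℂ ℂ).comp u.toLinearMap)
      u.continuous.norm
    obtain ⟨p, hp, hdom⟩ := exists_dominating_seminorm h.one_le h.rapid_dual hC M
    refine summable_iff_vanishing.2 fun V hV => ?_
    obtain ⟨S, r, hS, hr, hSr⟩ := eventually_nhds_zero_strongDual hV
    obtain ⟨K, hK, hKS⟩ := exists_bound_of_isVonNBounded hS p hp
    -- The seminorm p is bounded by K on the bounded set S, so one tail of ∑ 1/w_i controls the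
    -- functionals on all of S at once. This gives strong, not only weak, convergence.
    obtain ⟨s, hs⟩ := summable_iff_vanishing.1 h.summable_inv (Metric.ball 0 (r / K))
      (Metric.ball_mem_nhds 0 (by positivity))
    refine ⟨s, fun t ht => hSr _ fun f hf => ?_⟩
    have h1 := hs t ht
    rw [mem_ball_zero_iff, Real.norm_eq_abs, lt_div_iff₀ hK] at h1
    refine lt_of_le_of_lt ?_ h1
    rw [sum_apply]
    refine (norm_sum_le _ _).trans ?_
    calc ∑ i ∈ t, ‖(u (a i) • toDist μ (b i)) f‖ ≤ ∑ i ∈ t, (w i)⁻¹ * K := by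
          refine Finset.sum_le_sum fun i _ => ?_
          rw [smul_apply, norm_smul, mul_comm]
          refine (mul_le_mul_of_nonneg_left (hCM i) (norm_nonneg _)).trans ((hdom i f).trans ?_)
          exact mul_le_mul_of_nonneg_left (hKS f hf)
            (inv_nonneg.2 (zero_le_one.trans (h.one_le i)))
      _ ≤ _ := by
          rw [← Finset.sum_mul]
          exact mul_le_mul_of_nonneg_right (le_abs_self _) hK.le
  have heq : ∑' i, u (a i) • toDist μ (b i) = u := by
    ext f
    have h1 : HasSum (fun i => (u (a i) • toDist μ (b i)) f) ((∑' i, u (a i) • toDist μ (b i)) f) :=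
      hsum.hasSum.map (LinearMap.applyₗ f ∘ₗ ContinuousLinearMap.coeLM ℂ :
        StrongDual ℂ 𝓢(E, ℂ) →ₗ[ℂ] ℂ) (ContinuousEvalConst.continuous_eval_const f)
    refine h1.unique ?_
    have h2 := (h.expand f).mapL u
    refine h2.congr_fun fun i => ?_
    rw [map_smul, smul_apply, smul_eq_mul, smul_eq_mul, mul_comm]
  have h3 := hsum.hasSum
  rwa [heq] at h3

/-- The embedding `𝓢(E) → 𝓢'(E)` is continuous for the strong topology. -/
def toDistCLM (μ : Measure E) [μ.HasTemperateGrowth] : 𝓢(E, ℂ) →L[ℂ] StrongDual ℂ 𝓢(E, ℂ) where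
  toFun := toDist μ
  map_add' := toDist_add
  map_smul' := toDist_smul
  cont := by
    let T : 𝓢(E, ℂ) →ₗ[ℂ] StrongDual ℂ 𝓢(E, ℂ) :=
      { toFun := toDist μ, map_add' := toDist_add, map_smul' := toDist_smul }
    refine continuous_of_continuousAt_zero T ?_
    rw [ContinuousAt, map_zero]
    intro V hV
    obtain ⟨S, r, hS, hr, hSr⟩ := eventually_nhds_zero_strongDual hV
    -- The pairing is separately continuous, hence bounded by p(F) q(f); since q is bounded on S,
    -- smallness of p(F) suffices.
    obtain ⟨p, q, hp, hq, hpq⟩ := SchwartzMap.exists_seminorm_bound_bilin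
      (fun _ : Unit => (ContinuousLinearMap.coeLM ℂ ∘ₗ T : 𝓢(E, ℂ) →ₗ[ℂ] 𝓢(E, ℂ) →ₗ[ℂ] ℂ))
      (fun _ F => (toDist μ F).continuous)
      (fun _ G => by
        have : (fun F => (ContinuousLinearMap.coeLM ℂ ∘ₗ T : 𝓢(E, ℂ) →ₗ[ℂ] 𝓢(E, ℂ) →ₗ[ℂ] ℂ) F G)
            = toDist μ G := by
          ext F
          exact toDist_symm F G
        rw [this]
        exact (toDist μ G).continuous)
      (fun F G => ⟨_, fun _ => le_rfl⟩)
    obtain ⟨K, hK, hKS⟩ := exists_bound_of_isVonNBounded hS q hq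
    have h0 : Tendsto p (𝓝 0) (𝓝 0) := by simpa using hp.tendsto 0
    rw [mem_map]
    filter_upwards [h0.eventually (gt_mem_nhds (div_pos hr hK))] with F hF
    refine hSr _ fun f hf => ?_
    rw [lt_div_iff₀ hK] at hF
    exact ((hpq () F f).trans (mul_le_mul_of_nonneg_left (hKS f hf) (apply_nonneg _ _))).trans_lt hF

end Frames

end AbstractComposition

namespace AbstractComposition

/-! ### Tensor frames -/

section TensorFrame

variable {n : ℕ} {ι κ : Type*}

lemma toDist_tensor (f₁ f₂ g₁ g₂ : 𝓢(Phase n, ℂ)) :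
    toDist (doubleMeasure n) (tensor f₁ f₂) (tensor g₁ g₂)
      = toDist (phaseMeasure n) f₁ g₁ * toDist (phaseMeasure n) f₂ g₂ := by
  simp only [toDist_apply, tensor_apply]
  rw [doubleMeasure, ← integral_prod_mul]
  refine integral_congr_ae (Eventually.of_forall fun P => ?_)
  ring

/-- A frame of `𝓢(Ξ)` whose elementary tensors form a frame of `𝓢(Ξ × Ξ)`. -/
structure IsTensorFrame (w : ι → ℝ) (a b : ι → 𝓢(Phase n, ℂ)) : Prop where
  frame : IsSchwartzFrame (phaseMeasure n) w a b
  tensor_frame : IsSchwartzFrame (doubleMeasure n) (fun p : ι × ι => w p.1 * w p.2)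
    (fun p => tensor (a p.1) (a p.2)) (fun p => tensor (b p.1) (b p.2))

variable {w : ι → ℝ} {a b : ι → 𝓢(Phase n, ℂ)}

/-- The frame expansion writes every F as a convergent series of multiples of elementary tensors. -/
lemma IsTensorFrame.clm_ext (h : IsTensorFrame w a b) {X : Type*} [AddCommGroup X] [Module ℂ X]
    [TopologicalSpace X] [T2Space X] {S T : 𝓢(Phase n × Phase n, ℂ) →L[ℂ] X}
    (hST : ∀ f g, S (tensor f g) = T (tensor f g)) : S = T := by
  ext F
  have h1 := (h.tensor_frame.expand F).mapL S
  have h2 := (h.tensor_frame.expand F).mapL T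
  refine h1.unique (h2.congr_fun fun i => ?_)
  rw [map_smul, map_smul, hST]

/-- Separately continuous bilinear forms on `𝓢(Ξ)` extend to functionals on `𝓢(Ξ × Ξ)`, and
pointwise bounded families extend to pointwise bounded families. -/
lemma IsTensorFrame.exists_extension (h : IsTensorFrame w a b)
    (β : κ → 𝓢(Phase n, ℂ) →ₗ[ℂ] 𝓢(Phase n, ℂ) →ₗ[ℂ] ℂ)
    (hr : ∀ i f, Continuous (β i f)) (hl : ∀ i g, Continuous fun f => β i f g)
    (hβ : ∀ f g, ∃ C, ∀ i, ‖β i f g‖ ≤ C) :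
    ∃ u : κ → StrongDual ℂ 𝓢(Phase n × Phase n, ℂ), (∀ k f g, u k (tensor f g) = β k f g) ∧
      ∀ F, ∃ K, ∀ k, ‖u k F‖ ≤ K := by
  -- A joint bound p(f) q(g), uniform in the parameter, makes the values on pairs of atoms grow
  -- polynomially in w_i w_j; the extension is synthesised from these values.
  obtain ⟨p, q, hp, hq, hpq⟩ := SchwartzMap.exists_seminorm_bound_bilin β hr hl hβ
  obtain ⟨C₁, M₁, hC₁, h₁⟩ := h.frame.poly_atom p hp
  obtain ⟨C₂, M₂, hC₂, h₂⟩ := h.frame.poly_atom q hq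
  obtain ⟨u, hu, hub⟩ := exists_functionals_hasSum h.tensor_frame.one_le
    h.tensor_frame.summable_inv h.tensor_frame.rapid_dual
    (c := fun k i => β k (a i.1) (a i.2)) (C := C₁ * C₂) (M := M₁ + M₂) (by positivity)
    (fun k i => by
      have hw1 := h.frame.one_le i.1
      have hw2 := h.frame.one_le i.2
      have hw1' : 0 ≤ w i.1 := zero_le_one.trans hw1
      have hw2' : 0 ≤ w i.2 := zero_le_one.trans hw2
      calc ‖β k (a i.1) (a i.2)‖ ≤ p (a i.1) * q (a i.2) := hpq _ _ _
        _ ≤ (C₁ * w i.1 ^ M₁) * (C₂ * w i.2 ^ M₂) :=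
          mul_le_mul (h₁ _) (h₂ _) (apply_nonneg _ _) (by positivity)
        _ ≤ (C₁ * w i.1 ^ (M₁ + M₂)) * (C₂ * w i.2 ^ (M₁ + M₂)) := by
          refine mul_le_mul
            (mul_le_mul_of_nonneg_left (pow_le_pow_right₀ hw1 (Nat.le_add_right _ _)) hC₁)
            (mul_le_mul_of_nonneg_left (pow_le_pow_right₀ hw2 (Nat.le_add_left _ _)) hC₂)
            (by positivity) (by positivity)
        _ = C₁ * C₂ * (w i.1 * w i.2) ^ (M₁ + M₂) := by rw [mul_pow]; ring)
  refine ⟨u, fun k f g => ?_, hub⟩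
  have h1 := hu k (tensor f g)
  let L : StrongDual ℂ 𝓢(Phase n, ℂ) := ⟨(β k).flip g, hl k g⟩
  let R : 𝓢(Phase n, ℂ) → StrongDual ℂ 𝓢(Phase n, ℂ) := fun f => ⟨β k f, hr k f⟩
  -- To recover the form on f ⊗ g, the double series is summed over j first and then over i, so each
  -- summation uses continuity in one variable only.
  have h2 : ∀ i, HasSum (fun j => toDist (doubleMeasure n) (tensor (b i) (b j)) (tensor f g)
      * β k (a i) (a j)) (toDist (phaseMeasure n) (b i) f * β k (a i) g) := by
    intro i
    have := ((h.frame.expand g).mapL (R (a i))).mul_left (toDist (phaseMeasure n) (b i) f)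
    refine this.congr_fun fun j => ?_
    rw [toDist_tensor, map_smul, smul_eq_mul, mul_assoc]
    rfl
  have h3 := h1.prod_fiberwise h2
  have h4 := (h.frame.expand f).mapL L
  refine h3.unique (h4.congr_fun fun i => ?_)
  rw [map_smul, smul_eq_mul]
  rfl

/-- Synthesis of a continuous linear map on `𝓢(Ξ × Ξ)` from bilinear coefficients. -/
lemma IsTensorFrame.exists_clm (h : IsTensorFrame w a b)
    (β : ι × ι → 𝓢(Phase n, ℂ) →ₗ[ℂ] 𝓢(Phase n, ℂ) →ₗ[ℂ] ℂ)
    (hr : ∀ i f, Continuous (β i f)) (hl : ∀ i g, Continuous fun f => β i f g)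
    (hβ : ∀ f g, RapidlyDecreasing (fun p : ι × ι => w p.1 * w p.2) fun i => β i f g)
    {B : ι × ι → 𝓢(Phase n × Phase n, ℂ)}
    (hB : PolyBounded (fun p : ι × ι => w p.1 * w p.2) B) :
    ∃ A : 𝓢(Phase n × Phase n, ℂ) →L[ℂ] 𝓢(Phase n × Phase n, ℂ),
      ∀ f g, HasSum (fun i => β i f g • B i) (A (tensor f g)) := by
  obtain ⟨u, hu, -⟩ := h.exists_extension β hr hl fun f g => by
    obtain ⟨C, hC⟩ := hβ f g 0
    exact ⟨C, fun i => by simpa using hC i⟩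
  have hrapid : ∀ F, RapidlyDecreasing (fun p : ι × ι => w p.1 * w p.2) fun i => u i F := by
    intro F N
    have hnorm : ∀ i : ι × ι, ‖(((w i.1 * w i.2) ^ N : ℝ) : ℂ)‖ = (w i.1 * w i.2) ^ N := fun i => by
      have h1 := zero_le_one.trans (h.frame.one_le i.1)
      have h2 := zero_le_one.trans (h.frame.one_le i.2)
      rw [Complex.norm_real, Real.norm_eq_abs, abs_of_nonneg (by positivity)]
    -- The rescaled forms w^N β_i are still pointwise bounded, hence so are their extensions. By
    -- uniqueness these are w^N u_i, which carries rapid decrease from tensors to every F.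
    obtain ⟨v, hv, hvb⟩ := h.exists_extension
      (fun i => (((w i.1 * w i.2) ^ N : ℝ) : ℂ) • β i)
      (fun i f => (hr i f).const_smul _) (fun i g => (hl i g).const_smul _) (fun f g => by
        obtain ⟨C, hC⟩ := hβ f g N
        refine ⟨C, fun i => ?_⟩
        rw [LinearMap.smul_apply, LinearMap.smul_apply, norm_smul, hnorm]
        exact hC i)
    obtain ⟨K, hK⟩ := hvb F
    refine ⟨K, fun i => (hK i).trans' (le_of_eq ?_)⟩
    have : v i = (((w i.1 * w i.2) ^ N : ℝ) : ℂ) • u i := h.clm_ext fun f g => by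
      have h1 : (u i) (tensor f g) = β i f g := hu i f g
      rw [hv]
      change _ = (((w i.1 * w i.2) ^ N : ℝ) : ℂ) • u i (tensor f g)
      rw [h1]
      rfl
    rw [this, smul_apply, norm_smul, hnorm]
  obtain ⟨A, hA⟩ := exists_clm_hasSum h.tensor_frame.one_le h.tensor_frame.summable_inv hrapid hB
  refine ⟨A, fun f g => (hA (tensor f g)).congr_fun fun i => ?_⟩
  rw [hu]

/-- The tensor product of two continuous linear maps of `𝓢(Ξ)`. -/
lemma IsTensorFrame.exists_map_tensor (h : IsTensorFrame w a b)
    (P Q : 𝓢(Phase n, ℂ) →L[ℂ] 𝓢(Phase n, ℂ)) :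
    ∃ A : 𝓢(Phase n × Phase n, ℂ) →L[ℂ] 𝓢(Phase n × Phase n, ℂ),
      ∀ f g, A (tensor f g) = tensor (P f) (Q g) := by
  obtain ⟨A, hA⟩ := h.exists_clm
    (fun i => (LinearMap.mul ℂ ℂ).compl₁₂ ((toDist (phaseMeasure n) (b i.1)).comp P).toLinearMap
      ((toDist (phaseMeasure n) (b i.2)).comp Q).toLinearMap)
    (fun i f => continuous_const.mul ((toDist (phaseMeasure n) (b i.2)).comp Q).continuous)
    (fun i g => ((toDist (phaseMeasure n) (b i.1)).comp P).continuous.mul continuous_const)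
    (fun f g N => by
      obtain ⟨C₁, h₁⟩ := h.frame.rapid_dual (P f) N
      obtain ⟨C₂, h₂⟩ := h.frame.rapid_dual (Q g) N
      refine ⟨C₁ * C₂, fun i => ?_⟩
      have hw1 := zero_le_one.trans (h.frame.one_le i.1)
      have hw2 := zero_le_one.trans (h.frame.one_le i.2)
      change (w i.1 * w i.2) ^ N * ‖toDist (phaseMeasure n) (b i.1) (P f) *
        toDist (phaseMeasure n) (b i.2) (Q g)‖ ≤ _
      rw [norm_mul, mul_pow, mul_mul_mul_comm]
      exact mul_le_mul (h₁ _) (h₂ _) (by positivity) ((h₁ i.1).trans' (by positivity)))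
    h.tensor_frame.poly_atom
  refine ⟨A, fun f g => (hA f g).unique ?_⟩
  refine (h.tensor_frame.expand (tensor (P f) (Q g))).congr_fun fun i => ?_
  rw [toDist_tensor]
  rfl

/-! ### Transposes -/

/-- `A'` is the transpose of `A` for the duality `⟪F, G⟫ = ∫∫ F(X, Y) G(X, Y) dX dY`. -/
def IsTranspose (A A' : 𝓢(Phase n × Phase n, ℂ) →L[ℂ] 𝓢(Phase n × Phase n, ℂ)) : Prop :=
  ∀ F G, toDist (doubleMeasure n) (A F) G = toDist (doubleMeasure n) F (A' G)

lemma IsTranspose.symm {A A' : 𝓢(Phase n × Phase n, ℂ) →L[ℂ] 𝓢(Phase n × Phase n, ℂ)}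
    (h : IsTranspose A A') : IsTranspose A' A := fun F G => by
  rw [toDist_symm, ← h, toDist_symm]

lemma IsTranspose.comp {A A' B B' : 𝓢(Phase n × Phase n, ℂ) →L[ℂ] 𝓢(Phase n × Phase n, ℂ)}
    (h : IsTranspose A A') (h' : IsTranspose B B') : IsTranspose (A.comp B) (B'.comp A') :=
  fun F G => by
    rw [ContinuousLinearMap.comp_apply, h, h']
    rfl

/-- Density of the span of tensors is used one argument at a time: first in the test function, then
in F. -/
lemma IsTensorFrame.isTranspose (h : IsTensorFrame w a b)
    {A A' : 𝓢(Phase n × Phase n, ℂ) →L[ℂ] 𝓢(Phase n × Phase n, ℂ)}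
    (hA : ∀ f₁ f₂ g₁ g₂, toDist (doubleMeasure n) (A (tensor f₁ f₂)) (tensor g₁ g₂)
      = toDist (doubleMeasure n) (tensor f₁ f₂) (A' (tensor g₁ g₂))) : IsTranspose A A' := by
  have h1 : ∀ f₁ f₂, toDist (doubleMeasure n) (A (tensor f₁ f₂))
      = (toDist (doubleMeasure n) (tensor f₁ f₂)).comp A' := fun f₁ f₂ =>
    h.clm_ext fun g₁ g₂ => hA f₁ f₂ g₁ g₂
  intro F G
  have h2 : (toDist (doubleMeasure n) G).comp A = toDist (doubleMeasure n) (A' G) :=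
    h.clm_ext fun f₁ f₂ => by
      rw [ContinuousLinearMap.comp_apply, toDist_symm, h1, ContinuousLinearMap.comp_apply,
        toDist_symm]
  rw [toDist_symm, ← ContinuousLinearMap.comp_apply, h2, toDist_symm]

lemma toTemperedDistributionCLM_eq (F G : 𝓢(Phase n × Phase n, ℂ)) :
    SchwartzMap.toTemperedDistributionCLM _ ℂ (doubleMeasure n) F G
      = toDist (doubleMeasure n) F G := by
  rfl

/-- A map with a transpose extends uniquely to tempered distributions. -/
lemma IsTensorFrame.extendsUniquely (h : IsTensorFrame w a b)
    {A A' : 𝓢(Phase n × Phase n, ℂ) →L[ℂ] 𝓢(Phase n × Phase n, ℂ)} (hA : IsTranspose A A') :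
    ExtendsUniquely A := by
  constructor
  -- Precomposition with the transpose is the extension. Any other agrees with it on the Schwartz
  -- functions b_i ⊗ b_j, hence on every u by the strongly convergent expansion.
  · refine ⟨ContinuousLinearMap.precomp ℂ A', fun F => ?_, fun B hB => ?_⟩
    · ext G
      exact (hA F G).symm
    · ext1 u
      have h1 := (h.tensor_frame.hasSum_strongDual u).mapL B
      have h2 := (h.tensor_frame.hasSum_strongDual u).mapL
        (ContinuousLinearMap.precomp ℂ A' : StrongDual ℂ 𝓢(Phase n × Phase n, ℂ) →L[ℂ]
          StrongDual ℂ 𝓢(Phase n × Phase n, ℂ))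
      refine h1.unique (h2.congr_fun fun i => ?_)
      rw [map_smul, map_smul, hB]
      congr 1
      ext G
      exact hA _ G
  · refine ⟨PointwiseConvergenceCLM.precomp ℂ A', fun F => ?_, fun B hB => ?_⟩
    · ext G
      rw [PointwiseConvergenceCLM.precomp_apply]
      change SchwartzMap.toTemperedDistributionCLM _ ℂ (doubleMeasure n) F (A' G) = _
      rw [toTemperedDistributionCLM_eq, toTemperedDistributionCLM_eq]
      exact (hA F G).symm
    · ext1 u
      -- For the weak topology, convergence is obtained by applying u to the expansion of each test
      -- function.
      have hu : HasSum (fun i : ι × ι => u (tensor (a i.1) (a i.2)) •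
          SchwartzMap.toTemperedDistributionCLM _ ℂ (doubleMeasure n) (tensor (b i.1) (b i.2)))
          u := by
        refine PointwiseConvergenceCLM.tendsto_iff_forall_tendsto.2 fun G => ?_
        have h3 := (h.tensor_frame.expand G).mapL (u : StrongDual ℂ 𝓢(Phase n × Phase n, ℂ))
        refine (h3 : Tendsto _ _ _).congr fun s => ?_
        rw [sum_apply]
        refine Finset.sum_congr rfl fun i _ => ?_
        rw [smul_apply, toTemperedDistributionCLM_eq, smul_eq_mul, mul_comm]
        exact map_smul (u : StrongDual ℂ 𝓢(Phase n × Phase n, ℂ)) _ _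
      have h1 := hu.mapL B
      have h2 := hu.mapL (PointwiseConvergenceCLM.precomp ℂ A')
      refine h1.unique (h2.congr_fun fun i => ?_)
      rw [map_smul, map_smul, hB]
      congr 1
      ext G
      rw [toTemperedDistributionCLM_eq, hA]
      exact (toTemperedDistributionCLM_eq _ _).symm

end TensorFrame

end AbstractComposition

namespace AbstractComposition

/-! ### Uniform boundedness for `ℓ¹` sums -/

/-- If `∑ l, x l * y k l` is bounded in `k` for every summable `x`, then `y` is bounded. -/
lemma exists_bound_of_summable {ι κ : Type*} {y : κ → ι → ℂ} (hy : ∀ k, ∃ C, ∀ l, ‖y k l‖ ≤ C)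
    (h : ∀ x : ι → ℂ, (Summable fun l => ‖x l‖) → ∃ C, ∀ k, ‖∑' l, x l * y k l‖ ≤ C) :
    ∃ C, ∀ k l, ‖y k l‖ ≤ C := by
  classical
  have hx : ∀ x : lp (fun _ : ι => ℂ) 1, HasSum (fun l => ‖x l‖) ‖x‖ := fun x => by
    simpa using lp.hasSum_norm (p := 1) (by simp) x
  have hs : ∀ k (x : lp (fun _ : ι => ℂ) 1), Summable fun l => x l * y k l := fun k x => by
    obtain ⟨C, hC⟩ := hy k
    refine Summable.of_norm_bounded ((hx x).summable.mul_right C) fun l => ?_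
    rw [norm_mul]
    exact mul_le_mul_of_nonneg_left (hC l) (norm_nonneg _)
  have hex : ∀ k, ∃ u : lp (fun _ : ι => ℂ) 1 →L[ℂ] ℂ, ∀ x, u x = ∑' l, x l * y k l := fun k => by
    obtain ⟨C, hC⟩ := hy k
    refine ⟨LinearMap.mkContinuous
      { toFun := fun x : lp (fun _ : ι => ℂ) 1 => ∑' l, x l * y k l
        map_add' := fun x z => by
          simp only [lp.coeFn_add, Pi.add_apply, add_mul]
          exact (hs k x).tsum_add (hs k z)
        map_smul' := fun c x => by
          simp only [lp.coeFn_smul, Pi.smul_apply, smul_eq_mul, mul_assoc, RingHom.id_apply]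
          exact (hs k x).tsum_mul_left c } C (fun x => ?_), fun x => rfl⟩
    rw [mul_comm]
    refine tsum_of_norm_bounded ((hx x).mul_right C) fun l => ?_
    rw [norm_mul]
    exact mul_le_mul_of_nonneg_left (hC l) (norm_nonneg _)
  choose u hu using hex
  -- Each bounded sequence `y k` acts on ℓ¹; a common bound on the operator norms, tested on unit
  -- vectors, bounds all the entries.
  obtain ⟨C, hC⟩ := banach_steinhaus (g := u) fun x => by
    obtain ⟨C, hC⟩ := h x (hx x).summable
    exact ⟨C, fun k => by rw [hu]; exact hC k⟩
  refine ⟨C, fun k l => ?_⟩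
  have h1 := (u k).le_of_opNorm_le (hC k) (lp.single 1 l (1 : ℂ))
  rw [lp.norm_single (by simp), norm_one, mul_one, hu, tsum_eq_single l (fun l' hl' =>
    mul_eq_zero_of_left (lp.single_apply_ne (E := fun _ : ι => ℂ) 1 l 1 hl') _),
    lp.single_apply_self, one_mul] at h1
  exact h1

/-! ### Composition laws -/

section Law

variable {n : ℕ} {mul : 𝓢(Phase n, ℂ) →ₗ[ℂ] 𝓢(Phase n, ℂ) →ₗ[ℂ] 𝓢(Phase n, ℂ)}
  {ι : Type*} {w : ι → ℝ} {a b : ι → 𝓢(Phase n, ℂ)}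

/-- The trace `∫ f(X) dX`. -/
def trace (f : 𝓢(Phase n, ℂ)) : ℂ := ∫ X, f X ∂(phaseMeasure n)

lemma HypothesisA.toDist_eq_trace (hA : HypothesisA mul) (f g : 𝓢(Phase n, ℂ)) :
    toDist (phaseMeasure n) f g = trace (mul f g) := by
  rw [toDist_apply, trace, hA.integral_mul]
  exact integral_congr_ae (Eventually.of_forall fun x => mul_comm _ _)

lemma HypothesisA.pair_eq_trace (hA : HypothesisA mul) (f g : 𝓢(Phase n, ℂ)) :
    pair f g = trace (mul f g) := (hA.integral_mul f g).symm

/-- The trace of a product is the pairing ∫ f g, which is symmetric; with associativity this yields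
cyclicity. -/
lemma HypothesisA.trace_comm (hA : HypothesisA mul) (f g : 𝓢(Phase n, ℂ)) :
    trace (mul f g) = trace (mul g f) := by
  rw [← hA.toDist_eq_trace, toDist_symm, hA.toDist_eq_trace]

/-- Hypothesis B enters here. It is purely qualitative, about one distribution at a time; applying
it to all ℓ¹ combinations of weighted atoms and invoking Banach–Steinhaus turns it into a joint
estimate in both indices. -/
lemma HypothesisB.rapidlyDecreasing {hA : HypothesisA mul} (hB : HypothesisB hA)
    (hT : IsTensorFrame w a b) (f g : 𝓢(Phase n, ℂ)) :
    RapidlyDecreasing (fun p : ι × ι => w p.1 * w p.2)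
      fun p => toDist (phaseMeasure n) (a p.1) (mul (mul f (a p.2)) g) := by
  intro N
  have hw0 : ∀ i, 0 ≤ w i := fun i => zero_le_one.trans (hT.frame.one_le i)
  have hnorm : ∀ i, ‖((w i ^ N : ℝ) : ℂ)‖ = w i ^ N := fun i => by
    rw [Complex.norm_real, Real.norm_eq_abs, abs_of_nonneg (pow_nonneg (hw0 i) N)]
  let v : ι → StrongDual ℂ 𝓢(Phase n, ℂ) := fun l =>
    ((w l ^ N : ℝ) : ℂ) • toDist (phaseMeasure n) (a l)
  obtain ⟨p, hp, hv⟩ := SchwartzMap.exists_seminorm_bound v fun h => by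
    obtain ⟨C, hC⟩ := hT.frame.rapid_atom h N
    refine ⟨C, fun l => ?_⟩
    rw [smul_apply, norm_smul, hnorm]
    exact hC l
  -- Cyclicity of the trace exchanges the two atoms, so the matrix produced by testing f # u # g on
  -- atoms is the one in the statement.
  have hcyc : ∀ k l, toDist (phaseMeasure n) (a l) (mul (mul g (a k)) f)
      = toDist (phaseMeasure n) (a k) (mul (mul f (a l)) g) := fun k l => by
    have h1 := hA.trace_comm (mul (a l) g) (mul (a k) f)
    rw [hA.toDist_eq_trace, hA.toDist_eq_trace]
    simp only [hA.assoc] at h1 ⊢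
    exact h1
  obtain ⟨C, hC⟩ := exists_bound_of_summable
    (y := fun k l => ((w k ^ N : ℝ) : ℂ) * v l (mul (mul g (a k)) f))
    (fun k => ⟨w k ^ N * p (mul (mul g (a k)) f), fun l => by
      rw [norm_mul, hnorm]
      exact mul_le_mul_of_nonneg_left (hv l _) (pow_nonneg (hw0 k) N)⟩)
    -- Since the `v l` share the bound p, the series ∑ x_l v_l is a distribution u. Its values on g
    -- # a_k # f are the pairings of the Schwartz function f # u # g with a_k, which decrease
    -- rapidly in k.
    (fun x hx => by
      obtain ⟨u, hu, -⟩ := exists_functional_of_dominated hx (fun _ => norm_nonneg _)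
        (α := fun l => x l • v l) hp (fun l F => by
          rw [smul_apply, norm_smul]
          exact mul_le_mul_of_nonneg_left (hv l F) (norm_nonneg _))
      obtain ⟨h, hh⟩ := hB f g u
      obtain ⟨C, hC⟩ := hT.frame.rapid_atom h N
      refine ⟨C, fun k => (hC k).trans' (le_of_eq ?_)⟩
      have h1 : u (mul (mul g (a k)) f) = toDist (phaseMeasure n) (a k) h := by
        rw [toDist_symm, ← hh]
        rfl
      have h2 : ∑' l, x l * (((w k ^ N : ℝ) : ℂ) * v l (mul (mul g (a k)) f))
          = ((w k ^ N : ℝ) : ℂ) * u (mul (mul g (a k)) f) := by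
        rw [← (hu _).tsum_eq, ← tsum_mul_left]
        refine tsum_congr fun l => ?_
        exact mul_left_comm _ _ _
      rw [h2, norm_mul, hnorm, h1])
  refine ⟨C, fun i => (hC i.1 i.2).trans' (le_of_eq ?_)⟩
  change _ = ‖((w i.1 ^ N : ℝ) : ℂ) *
    (((w i.2 ^ N : ℝ) : ℂ) * toDist (phaseMeasure n) (a i.2) (mul (mul g (a i.1)) f))‖
  rw [norm_mul, norm_mul, hnorm, hnorm, hcyc, mul_pow, mul_assoc]

/-- The kernel map: `⟪A(f₁ ⊗ f₂), g₁ ⊗ g₂⟫ = ∫ g₁ # f₁ # g₂ # f₂`. -/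
lemma HypothesisB.exists_kernelMap {hA : HypothesisA mul} (hB : HypothesisB hA)
    (hT : IsTensorFrame w a b) :
    ∃ A : 𝓢(Phase n × Phase n, ℂ) →L[ℂ] 𝓢(Phase n × Phase n, ℂ), ∀ f₁ f₂ g₁ g₂,
      toDist (doubleMeasure n) (A (tensor f₁ f₂)) (tensor g₁ g₂)
        = trace (mul (mul g₁ f₁) (mul g₂ f₂)) := by
  obtain ⟨A, hA'⟩ := hT.exists_clm
    (fun i => (mul.comp (mul.flip (a i.2))).compr₂ (toDist (phaseMeasure n) (a i.1)).toLinearMap)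
    (fun i f => (toDist (phaseMeasure n) (a i.1)).continuous.comp (hA.continuous_left _))
    (fun i g => (toDist (phaseMeasure n) (a i.1)).continuous.comp
      ((hA.continuous_right g).comp (hA.continuous_right (a i.2))))
    (fun f g => hB.rapidlyDecreasing hT f g) hT.tensor_frame.poly_dual
  refine ⟨A, fun f₁ f₂ g₁ g₂ => ?_⟩
  -- For fixed f₁, f₂ the target trace is separately continuous in (g₁, g₂), so it extends to a
  -- functional that can be applied termwise to the frame expansion of g₁ ⊗ g₂ and compared with the
  -- series for A.
  obtain ⟨u, hu, -⟩ := hT.exists_extension (κ := Unit)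
    (fun _ => LinearMap.compl₁₂
      ((mul.compr₂ (SchwartzMap.integralCLM ℂ (phaseMeasure n)).toLinearMap))
      LinearMap.id (mul.flip f₂ ∘ₗ mul f₁))
    (fun _ g => (SchwartzMap.integralCLM ℂ (phaseMeasure n)).continuous.comp
      ((hA.continuous_left g).comp ((hA.continuous_right f₂).comp (hA.continuous_left f₁))))
    (fun _ g => (SchwartzMap.integralCLM ℂ (phaseMeasure n)).continuous.comp
      (hA.continuous_right _))
    (fun f g => ⟨_, fun _ => le_rfl⟩)
  have hu' : ∀ g₁ g₂, u () (tensor g₁ g₂) = trace (mul g₁ (mul (mul f₁ g₂) f₂)) := fun g₁ g₂ => by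
    rw [hu]
    exact SchwartzMap.integralCLM_apply ℂ _
  have h1 := (hA' f₁ f₂).mapL (toDist (doubleMeasure n) (tensor g₁ g₂))
  have h2 := (hT.tensor_frame.expand (tensor g₁ g₂)).mapL (u ())
  have h3 : u () (tensor g₁ g₂) = trace (mul (mul g₁ f₁) (mul g₂ f₂)) := by
    rw [hu']
    simp only [hA.assoc]
  rw [toDist_symm, ← h3]
  refine h1.unique (h2.congr_fun fun i => ?_)
  rw [map_smul, map_smul, hu', smul_eq_mul, smul_eq_mul, toDist_symm, mul_comm,
    ← hA.toDist_eq_trace]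
  rfl

end Law

/-! ### The symplectic Fourier transform and the changes of variables -/

section Transposes

variable {n : ℕ} {ι : Type*} {w : ι → ℝ} {a b : ι → 𝓢(Phase n, ℂ)}

lemma sigma_symm (X Y : Phase n) : sigma X Y = -sigma Y X := by
  simp only [sigma, neg_sub]

/-- The reflected symplectic Fourier transform, `f ↦ f̂(-X)`. -/
def reflectedFourier (n : ℕ) : 𝓢(Phase n, ℂ) →L[ℂ] 𝓢(Phase n, ℂ) :=
  (SchwartzMap.compCLMOfContinuousLinearEquiv ℂ (ContinuousLinearEquiv.neg ℝ)).comp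
    (symplecticFourier n)

/-- Fubini moves the kernel exp(-iσ(Y, Z)) to g, where the integration runs over its first argument;
antisymmetry of σ turns this into ĝ(-Z). -/
lemma toDist_symplecticFourier (f g : 𝓢(Phase n, ℂ)) :
    toDist (phaseMeasure n) (symplecticFourier n f) g
      = toDist (phaseMeasure n) f (reflectedFourier n g) := by
  have hint : Integrable (Function.uncurry fun Y Z : Phase n =>
      Complex.exp (-(Complex.I * (sigma Y Z : ℂ))) * (g Y * f Z))
      ((phaseMeasure n).prod (phaseMeasure n)) := by
    have h1 : Integrable (tensor g f) ((phaseMeasure n).prod (phaseMeasure n)) :=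
      SchwartzMap.integrable (μ := doubleMeasure n) (tensor g f)
    refine h1.bdd_mul (c := 1) (Continuous.aestronglyMeasurable ?_)
      (Eventually.of_forall fun P => ?_)
    · simp only [sigma]
      fun_prop
    · rw [← mul_neg, ← Complex.ofReal_neg, mul_comm, Complex.norm_exp_ofReal_mul_I]
  have h1 : ∀ Y, g Y * symplecticFourier n f Y = ∫ Z, Complex.exp (-(Complex.I * (sigma Y Z : ℂ)))
      * (g Y * f Z) ∂(phaseMeasure n) := fun Y => by
    rw [symplecticFourier_apply, ← integral_const_mul]
    exact integral_congr_ae (Eventually.of_forall fun Z => mul_left_comm _ _ _)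
  have h2 : ∀ Z, reflectedFourier n g Z * f Z = ∫ Y, Complex.exp (-(Complex.I * (sigma Y Z : ℂ)))
      * (g Y * f Z) ∂(phaseMeasure n) := fun Z => by
    have h3 : reflectedFourier n g Z = symplecticFourier n g (-Z) := rfl
    rw [h3, symplecticFourier_apply, ← integral_mul_const]
    refine integral_congr_ae (Eventually.of_forall fun Y => ?_)
    have h4 : sigma (-Z) Y = sigma Y Z := by
      rw [sigma_symm Y Z]
      simp [sigma, Finset.sum_neg_distrib]
      ring
    simp only [h4, mul_assoc]
  rw [toDist_apply, toDist_apply]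
  simp only [h1, h2]
  exact integral_integral_swap hint

/-- C is the reflection of both variables followed by the shear (X, Y) ↦ (X, Y - X). -/
lemma measurePreserving_changeVar (n : ℕ) :
    MeasurePreserving (changeVar n) (doubleMeasure n) (doubleMeasure n) := by
  have h1 : MeasurePreserving (fun z : Phase n × Phase n => -z) (doubleMeasure n)
      (doubleMeasure n) := by
    have : (phaseMeasure n).Regular := Measure.Regular.smul_nnreal _
    exact (Measure.measurePreserving_neg (phaseMeasure n)).prod
      (Measure.measurePreserving_neg (phaseMeasure n))
  have h2 : MeasurePreserving (fun z : Phase n × Phase n => (z.1, -z.1 + z.2)) (doubleMeasure n)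
      (doubleMeasure n) := measurePreserving_prod_neg_add _ _
  have h3 : (changeVar n : Phase n × Phase n → Phase n × Phase n)
      = (fun z => (z.1, -z.1 + z.2)) ∘ fun z => -z := by
    ext1 P
    simp [sub_eq_add_neg]
  rw [h3]
  exact h2.comp h1

lemma isTranspose_of_measurePreserving {e : (Phase n × Phase n) ≃L[ℝ] (Phase n × Phase n)}
    (he : MeasurePreserving e (doubleMeasure n) (doubleMeasure n)) :
    IsTranspose (SchwartzMap.compCLMOfContinuousLinearEquiv ℂ e)
      (SchwartzMap.compCLMOfContinuousLinearEquiv ℂ e.symm) := by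
  intro F G
  have h := he.integral_comp e.toHomeomorph.measurableEmbedding fun P => G (e.symm P) * F P
  rw [toDist_apply, toDist_apply]
  refine Eq.trans (integral_congr_ae (Eventually.of_forall fun P => ?_)) h
  simp

end Transposes

/-! ### The main theorem, for a given tensor frame -/

section Main

variable {n : ℕ} {mul : 𝓢(Phase n, ℂ) →ₗ[ℂ] 𝓢(Phase n, ℂ) →ₗ[ℂ] 𝓢(Phase n, ℂ)}
  {ι : Type*} {w : ι → ℝ} {a b : ι → 𝓢(Phase n, ℂ)}

lemma IsTensorFrame.ext_of_tensor (hT : IsTensorFrame w a b)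
    {S T : 𝓢(Phase n × Phase n, ℂ) →L[ℂ] StrongDual ℂ 𝓢(Phase n × Phase n, ℂ)}
    (h : ∀ f₁ f₂ g₁ g₂, S (tensor f₁ f₂) (tensor g₁ g₂) = T (tensor f₁ f₂) (tensor g₁ g₂)) :
    S = T :=
  hT.clm_ext fun f₁ f₂ => hT.clm_ext fun g₁ g₂ => h f₁ f₂ g₁ g₂

lemma IsTensorFrame.restrictsAndExtends (hT : IsTensorFrame w a b)
    {T : 𝓢(Phase n × Phase n, ℂ) →L[ℂ] StrongDual ℂ 𝓢(Phase n × Phase n, ℂ)}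
    {A A' : 𝓢(Phase n × Phase n, ℂ) →L[ℂ] 𝓢(Phase n × Phase n, ℂ)} (hA : IsTranspose A A')
    (h : ∀ F, T F = toDist (doubleMeasure n) (A F)) : RestrictsAndExtends T :=
  ⟨A, h, hT.extendsUniquely hA⟩

theorem IsTensorFrame.main (hT : IsTensorFrame w a b) (hA : HypothesisA mul)
    (hB : HypothesisB hA) :
    (∃! R, IsMapR mul R) ∧ (∃! N, IsMapN mul N) ∧
    (∀ R, IsMapR mul R → RestrictsAndExtends R) ∧
    (∀ N, IsMapN mul N → RestrictsAndExtends N ∧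
      RestrictsAndExtends (mapM N) ∧ RestrictsAndExtends (mapM' N)) := by
  obtain ⟨A, hAker⟩ := hB.exists_kernelMap hT
  let σ := SchwartzMap.compCLMOfContinuousLinearEquiv ℂ (F := ℂ)
    (ContinuousLinearEquiv.prodComm ℝ (Phase n) (Phase n))
  have hσ : ∀ f g, σ (tensor f g) = tensor g f := fun f g => by
    ext P
    exact mul_comm _ _
  -- τ(g₁ # f₁ # g₂ # f₂) = τ(f₁ # g₂ # f₂ # g₁): the roles of the f and the g are interchanged, up
  -- to the order of g₁ and g₂.
  have hAt : IsTranspose A (A.comp σ) := hT.isTranspose fun f₁ f₂ g₁ g₂ => by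
    have h1 := hA.trace_comm g₁ (mul f₁ (mul g₂ f₂))
    rw [hAker, toDist_symm, ContinuousLinearMap.comp_apply, hσ, hAker]
    simp only [hA.assoc] at h1 ⊢
    exact h1
  obtain ⟨D, hD⟩ := hT.exists_map_tensor (symplecticFourier n) (symplecticFourier n)
  obtain ⟨D', hD'⟩ := hT.exists_map_tensor (reflectedFourier n) (reflectedFourier n)
  have hDt : IsTranspose D D' := hT.isTranspose fun f₁ f₂ g₁ g₂ => by
    rw [hD, hD', toDist_tensor, toDist_tensor, toDist_symplecticFourier, toDist_symplecticFourier]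
  -- In N the Fourier transforms act on the test functions, so on the output they become the
  -- transpose D'.
  have hNt : IsTranspose (D'.comp A) ((A.comp σ).comp D) := hDt.symm.comp hAt
  have hCt := isTranspose_of_measurePreserving (measurePreserving_changeVar n)
  have hR : ∀ R, IsMapR mul R ↔ R = (toDistCLM (doubleMeasure n)).comp A := fun R => by
    have h0 : IsMapR mul ((toDistCLM (doubleMeasure n)).comp A) := fun f₁ f₂ g₁ g₂ => by
      rw [hA.pair_eq_trace, ← hAker]
      rfl
    refine ⟨fun h => hT.ext_of_tensor fun f₁ f₂ g₁ g₂ => ?_, fun h => h ▸ h0⟩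
    rw [h, h0]
  have hN : ∀ N, IsMapN mul N ↔ N = (toDistCLM (doubleMeasure n)).comp (D'.comp A) := fun N => by
    have h0 : IsMapN mul ((toDistCLM (doubleMeasure n)).comp (D'.comp A)) := fun f₁ f₂ g₁ g₂ => by
      rw [hA.pair_eq_trace, ← hAker, ← hD, ← hDt.symm]
      rfl
    refine ⟨fun h => hT.ext_of_tensor fun f₁ f₂ g₁ g₂ => ?_, fun h => h ▸ h0⟩
    rw [h, h0]
  refine ⟨⟨_, (hR _).2 rfl, fun R h => (hR R).1 h⟩, ⟨_, (hN _).2 rfl, fun N h => (hN N).1 h⟩,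
    fun R h => ?_, fun N h => ?_⟩
  · rw [(hR R).1 h]
    exact hT.restrictsAndExtends hAt fun F => rfl
  · rw [(hN N).1 h]
    refine ⟨hT.restrictsAndExtends hNt fun F => rfl,
      hT.restrictsAndExtends (hCt.comp hNt) fun F => ?_,
      hT.restrictsAndExtends (hNt.comp hCt) fun F => rfl⟩
    ext G
    exact (hCt _ G).symm

end Main

end AbstractComposition

namespace AbstractComposition

/-! ### Time-frequency shifts of a window -/

lemma one_add_norm_le_mul {V : Type*} [SeminormedAddCommGroup V] (x y : V) :
    1 + ‖x‖ ≤ (1 + ‖y‖) * (1 + ‖x - y‖) := by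
  have h1 : ‖x‖ ≤ ‖y‖ + ‖x - y‖ := by
    have := norm_add_le y (x - y)
    rwa [add_sub_cancel] at this
  nlinarith [norm_nonneg y, norm_nonneg (x - y)]

section Gabor

variable {V : Type*} [NormedAddCommGroup V] [NormedSpace ℝ V]

lemma supSeminorm_le {m : ℕ} {f : 𝓢(V, ℂ)} {K : ℝ} (hK : 0 ≤ K)
    (h : ∀ k ≤ m, ∀ l ≤ m, ∀ x, ‖x‖ ^ k * ‖iteratedFDeriv ℝ l f x‖ ≤ K) :
    SchwartzMap.supSeminorm V m f ≤ K := by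
  refine Seminorm.finset_sup_apply_le hK fun i hi => ?_
  obtain ⟨h1, h2⟩ := Finset.mem_Iic.1 hi
  exact SchwartzMap.seminorm_le_bound ℂ _ _ _ hK (h _ h1 _ h2)

lemma one_add_pow_le_supSeminorm {m k l : ℕ} (hk : k ≤ m) (hl : l ≤ m) (f : 𝓢(V, ℂ)) (x : V) :
    (1 + ‖x‖) ^ k * ‖iteratedFDeriv ℝ l f x‖ ≤ 2 ^ m * SchwartzMap.supSeminorm V m f :=
  SchwartzMap.one_add_le_sup_seminorm_apply (𝕜 := ℂ) (m := (m, m)) hk hl f x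

lemma iteratedFDeriv_translate (f : 𝓢(V, ℂ)) (y x : V) (l : ℕ) :
    iteratedFDeriv ℝ l (SchwartzMap.compSubConstCLM ℂ y f) x = iteratedFDeriv ℝ l f (x - y) := by
  have h : (SchwartzMap.compSubConstCLM ℂ y f : V → ℂ) = fun z => f (z - y) := by
    ext z
    exact SchwartzMap.compSubConstCLM_apply f y z
  rw [h, iteratedFDeriv_comp_sub]

lemma supSeminorm_translate_le (m : ℕ) (f : 𝓢(V, ℂ)) (y : V) :
    SchwartzMap.supSeminorm V m (SchwartzMap.compSubConstCLM ℂ y f)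
      ≤ (1 + ‖y‖) ^ m * (2 ^ m * SchwartzMap.supSeminorm V m f) := by
  have h0 : 0 ≤ SchwartzMap.supSeminorm V m f := apply_nonneg _ _
  refine supSeminorm_le (by positivity) fun k hk l hl x => ?_
  rw [iteratedFDeriv_translate]
  calc ‖x‖ ^ k * ‖iteratedFDeriv ℝ l f (x - y)‖
      ≤ ((1 + ‖y‖) * (1 + ‖x - y‖)) ^ k * ‖iteratedFDeriv ℝ l f (x - y)‖ := by
        gcongr
        linarith [one_add_norm_le_mul x y]
    _ = (1 + ‖y‖) ^ k * ((1 + ‖x - y‖) ^ k * ‖iteratedFDeriv ℝ l f (x - y)‖) := by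
        rw [mul_pow, mul_assoc]
    _ ≤ (1 + ‖y‖) ^ m * (2 ^ m * SchwartzMap.supSeminorm V m f) := by
        have h1 : (1 + ‖y‖) ^ k ≤ (1 + ‖y‖) ^ m :=
          pow_le_pow_right₀ (by linarith [norm_nonneg y]) hk
        exact mul_le_mul h1 (one_add_pow_le_supSeminorm hk hl f _) (by positivity) (by positivity)

lemma exists_translate_bound (q : Seminorm ℂ 𝓢(V, ℂ)) (hq : Continuous q) :
    ∃ (p : Seminorm ℂ 𝓢(V, ℂ)) (M : ℕ), Continuous p ∧
      ∀ y f, q (SchwartzMap.compSubConstCLM ℂ y f) ≤ (1 + ‖y‖) ^ M * p f := by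
  obtain ⟨C, m, hC, h⟩ := SchwartzMap.exists_le_supSeminorm q hq
  refine ⟨(C.toNNReal * 2 ^ m) • SchwartzMap.supSeminorm V m, m,
    (SchwartzMap.continuous_supSeminorm m).const_smul (C.toNNReal * 2 ^ m), fun y f => ?_⟩
  rw [smul_apply, NNReal.smul_def, smul_eq_mul]
  push_cast
  rw [Real.coe_toNNReal _ hC]
  calc _ ≤ C * SchwartzMap.supSeminorm V m (SchwartzMap.compSubConstCLM ℂ y f) := h _
    _ ≤ C * ((1 + ‖y‖) ^ m * (2 ^ m * SchwartzMap.supSeminorm V m f)) :=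
      mul_le_mul_of_nonneg_left (supSeminorm_translate_le m f y) hC
    _ = _ := by ring

/-- The product of `f` with the translate by `y` of the window `Φ`. -/
def localize (Φ : 𝓢(V, ℂ)) (y : V) (f : 𝓢(V, ℂ)) : 𝓢(V, ℂ) :=
  SchwartzMap.pairing (ContinuousLinearMap.mul ℂ ℂ) f (SchwartzMap.compSubConstCLM ℂ y Φ)

lemma localize_apply (Φ : 𝓢(V, ℂ)) (y : V) (f : 𝓢(V, ℂ)) (x : V) :
    localize Φ y f x = f x * Φ (x - y) := by
  rw [localize, SchwartzMap.pairing_apply_apply, SchwartzMap.compSubConstCLM_apply]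
  rfl

/-- By Leibniz, each term pairs a derivative of f at x with one of Φ at x - y. The weight in y is
split by (1 + ‖y‖)^N ≤ (1 + ‖x‖)^N (1 + ‖x - y‖)^N, and the N extra orders in the seminorms of f and
Φ absorb the two factors. -/
lemma exists_localize_bound (Φ f : 𝓢(V, ℂ)) (q : Seminorm ℂ 𝓢(V, ℂ)) (hq : Continuous q) (N : ℕ) :
    ∃ K, ∀ y, (1 + ‖y‖) ^ N * q (localize Φ y f) ≤ K := by
  obtain ⟨C, m, hC, h⟩ := SchwartzMap.exists_le_supSeminorm q hq
  set A := 2 ^ (m + N) * SchwartzMap.supSeminorm V (m + N) f with hA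
  set B := 2 ^ (m + N) * SchwartzMap.supSeminorm V (m + N) Φ with hB
  have hA0 : 0 ≤ A := mul_nonneg (by positivity) (apply_nonneg _ _)
  have hB0 : 0 ≤ B := mul_nonneg (by positivity) (apply_nonneg _ _)
  refine ⟨C * (2 ^ m * (A * B)), fun y => ?_⟩
  have hy0 : 0 < (1 + ‖y‖) ^ N := by positivity
  have key : SchwartzMap.supSeminorm V m (localize Φ y f)
      ≤ ((1 + ‖y‖) ^ N)⁻¹ * (2 ^ m * (A * B)) := by
    refine supSeminorm_le (by positivity) fun k hk l hl x => ?_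
    rw [← div_eq_inv_mul, le_div_iff₀ hy0]
    have hfun : (localize Φ y f : V → ℂ)
        = fun x => f x * SchwartzMap.compSubConstCLM ℂ y Φ x := by
      ext x
      rw [localize_apply, SchwartzMap.compSubConstCLM_apply]
    have hmul := norm_iteratedFDeriv_mul_le (𝕜 := ℝ) (n := l) (N := ((⊤ : ℕ∞) : WithTop ℕ∞))
      (f.smooth ⊤) ((SchwartzMap.compSubConstCLM ℂ y Φ).smooth ⊤) x (by exact_mod_cast le_top)
    rw [hfun]
    have hterm : ∀ i ∈ Finset.range (l + 1), ‖x‖ ^ k * ((l.choose i : ℝ) *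
        ‖iteratedFDeriv ℝ i f x‖ *
          ‖iteratedFDeriv ℝ (l - i) (SchwartzMap.compSubConstCLM ℂ y Φ) x‖) * (1 + ‖y‖) ^ N
        ≤ (l.choose i : ℝ) * (A * B) := by
      intro i hi
      have hil : i ≤ l := Nat.lt_succ_iff.1 (Finset.mem_range.1 hi)
      rw [iteratedFDeriv_translate]
      have h1 := one_add_pow_le_supSeminorm (m := m + N) (k := k + N) (l := i) (by omega)
        (by omega) f x
      have h2 := one_add_pow_le_supSeminorm (m := m + N) (k := N) (l := l - i) (by omega)
        (by omega) Φ (x - y)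
      have h3 : (1 + ‖y‖) ^ N ≤ (1 + ‖x‖) ^ N * (1 + ‖x - y‖) ^ N := by
        rw [← mul_pow]
        have := one_add_norm_le_mul y x
        rw [norm_sub_rev] at this
        gcongr
      calc _ = (l.choose i : ℝ) * (‖x‖ ^ k * ‖iteratedFDeriv ℝ i f x‖ *
            ‖iteratedFDeriv ℝ (l - i) Φ (x - y)‖ * (1 + ‖y‖) ^ N) := by ring
        _ ≤ (l.choose i : ℝ) * ((1 + ‖x‖) ^ k * ‖iteratedFDeriv ℝ i f x‖ *
            ‖iteratedFDeriv ℝ (l - i) Φ (x - y)‖ * ((1 + ‖x‖) ^ N * (1 + ‖x - y‖) ^ N)) := by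
          gcongr
          linarith
        _ = (l.choose i : ℝ) * (((1 + ‖x‖) ^ (k + N) * ‖iteratedFDeriv ℝ i f x‖) *
            ((1 + ‖x - y‖) ^ N * ‖iteratedFDeriv ℝ (l - i) Φ (x - y)‖)) := by
          rw [pow_add]; ring
        _ ≤ _ := mul_le_mul_of_nonneg_left (mul_le_mul h1 h2 (by positivity) hA0) (by positivity)
    calc _ ≤ ‖x‖ ^ k * (∑ i ∈ Finset.range (l + 1), (l.choose i : ℝ) * ‖iteratedFDeriv ℝ i f x‖ *
          ‖iteratedFDeriv ℝ (l - i) (SchwartzMap.compSubConstCLM ℂ y Φ) x‖) * (1 + ‖y‖) ^ N := by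
          gcongr
      _ ≤ ∑ i ∈ Finset.range (l + 1), (l.choose i : ℝ) * (A * B) := by
          rw [Finset.mul_sum, Finset.sum_mul]
          exact Finset.sum_le_sum hterm
      _ = 2 ^ l * (A * B) := by
          rw [← Finset.sum_mul]
          congr 1
          exact_mod_cast Nat.sum_range_choose l
      _ ≤ 2 ^ m * (A * B) := by
          gcongr
          norm_num
  calc (1 + ‖y‖) ^ N * q (localize Φ y f)
      ≤ (1 + ‖y‖) ^ N * (C * (((1 + ‖y‖) ^ N)⁻¹ * (2 ^ m * (A * B)))) := by
        gcongr
        exact (h _).trans (mul_le_mul_of_nonneg_left key hC)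
    _ = _ := by field_simp

end Gabor

/-! ### Size of Gabor atoms and decay of Gabor coefficients. -/

section GaborFourier

variable {V : Type*} [NormedAddCommGroup V] [InnerProductSpace ℝ V] [FiniteDimensional ℝ V]
  [MeasurableSpace V] [BorelSpace V]

/-- The time-frequency shift `x ↦ e^{2πi⟪ξ, x⟫} Φ(x - y)` of the window `Φ`. -/
def gaborAtom (Φ : 𝓢(V, ℂ)) (y ξ : V) : 𝓢(V, ℂ) :=
  𝓕⁻ (SchwartzMap.compSubConstCLM ℂ ξ (𝓕 (SchwartzMap.compSubConstCLM ℂ y Φ)))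

/-- Modulation is translation on the Fourier side. With the atom built from translations and Fourier
transforms, it is visibly Schwartz and its seminorms follow from translation bounds. -/
lemma gaborAtom_apply (Φ : 𝓢(V, ℂ)) (y ξ x : V) :
    gaborAtom Φ y ξ x = Complex.exp (2 * Real.pi * Complex.I * (inner ℝ ξ x : ℝ)) * Φ (x - y) := by
  set g := SchwartzMap.compSubConstCLM ℂ y Φ with hg
  have h1 : g x = 𝓕⁻ (((𝓕 g : 𝓢(V, ℂ)) : V → ℂ)) x := by
    have : 𝓕⁻ (𝓕 g) = g := FourierTransform.fourierInv_fourier_eq g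
    conv_lhs => rw [← this]
    rw [SchwartzMap.fourierInv_coe]
  have h2 : gaborAtom Φ y ξ x
      = 𝓕⁻ (fun η => (𝓕 g : 𝓢(V, ℂ)) (η - ξ)) x := by
    rw [gaborAtom, SchwartzMap.fourierInv_coe]
    congr 1
  have h3 : Φ (x - y) = g x := (SchwartzMap.compSubConstCLM_apply Φ y x).symm
  rw [h2, h3, h1, Real.fourierInv_eq', Real.fourierInv_eq', ← integral_const_mul,
    ← integral_add_right_eq_self _ ξ]
  refine integral_congr_ae (Eventually.of_forall fun η => ?_)
  simp only [smul_eq_mul, ← mul_assoc, ← Complex.exp_add, add_sub_cancel_right]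
  congr 2
  rw [inner_add_left]
  push_cast
  ring

lemma toDist_gaborAtom (Φ f : 𝓢(V, ℂ)) (y ξ : V) :
    toDist volume (gaborAtom Φ y ξ) f = 𝓕 (localize Φ y f) (-ξ) := by
  rw [toDist_apply, SchwartzMap.fourier_coe, Real.fourier_eq']
  refine integral_congr_ae (Eventually.of_forall fun x => ?_)
  simp only [localize_apply, gaborAtom_apply, smul_eq_mul, inner_neg_right]
  rw [mul_left_comm]
  congr 2
  rw [real_inner_comm]
  push_cast
  ring

variable {ι : Type*} {y ξ : ι → V} {w : ι → ℝ}

/-- A translation costs a power of 1 + the length of the shift; this is used once before and once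
after the Fourier transform. -/
lemma polyBounded_gaborAtom (Φ : 𝓢(V, ℂ)) (hw : ∀ i, (1 + ‖y i‖) * (1 + ‖ξ i‖) ≤ w i) :
    PolyBounded w fun i => gaborAtom Φ (y i) (ξ i) := by
  intro q hq
  obtain ⟨p₁, M₁, hp₁, h₁⟩ := exists_translate_bound
    (q.comp (FourierTransform.fourierInvCLM ℂ 𝓢(V, ℂ)).toLinearMap)
    (hq.comp (FourierTransform.fourierInvCLM ℂ 𝓢(V, ℂ)).continuous)
  obtain ⟨p₂, M₂, hp₂, h₂⟩ := exists_translate_bound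
    (p₁.comp (FourierTransform.fourierCLM ℂ 𝓢(V, ℂ)).toLinearMap)
    (hp₁.comp (FourierTransform.fourierCLM ℂ 𝓢(V, ℂ)).continuous)
  refine ⟨p₂ Φ, M₁ + M₂, apply_nonneg _ _, fun i => ?_⟩
  have hy : 1 ≤ 1 + ‖y i‖ := by linarith [norm_nonneg (y i)]
  have hξ : 1 ≤ 1 + ‖ξ i‖ := by linarith [norm_nonneg (ξ i)]
  have hyw : 1 + ‖y i‖ ≤ w i := (hw i).trans' (le_mul_of_one_le_right (by positivity) hξ)
  have hξw : 1 + ‖ξ i‖ ≤ w i := (hw i).trans' (le_mul_of_one_le_left (by positivity) hy)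
  calc q (gaborAtom Φ (y i) (ξ i))
      ≤ (1 + ‖ξ i‖) ^ M₁ * p₁ (𝓕 (SchwartzMap.compSubConstCLM ℂ (y i) Φ)) := h₁ _ _
    _ ≤ (1 + ‖ξ i‖) ^ M₁ * ((1 + ‖y i‖) ^ M₂ * p₂ Φ) :=
      mul_le_mul_of_nonneg_left (h₂ _ _) (by positivity)
    _ ≤ w i ^ M₁ * (w i ^ M₂ * p₂ Φ) := by
      have := apply_nonneg p₂ Φ
      have := hyw.trans' (zero_le_one.trans hy)
      gcongr
    _ = _ := by rw [pow_add]; ring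

/-- The coefficient is the Fourier transform at -ξ of f localised near y. Localisation gives decay
in y of every seminorm of this transform, and these seminorms give decay in ξ. -/
lemma rapidlyDecreasing_gaborAtom (Φ f : 𝓢(V, ℂ)) (hw0 : ∀ i, 0 ≤ w i) {C : ℝ} {M : ℕ}
    (hw : ∀ i, w i ≤ C * ((1 + ‖y i‖) * (1 + ‖ξ i‖)) ^ M) :
    RapidlyDecreasing w fun i => toDist volume (gaborAtom Φ (y i) (ξ i)) f := by
  intro N
  obtain ⟨K, hK⟩ := exists_localize_bound Φ f
    ((SchwartzMap.supSeminorm V (M * N)).comp (FourierTransform.fourierCLM ℂ 𝓢(V, ℂ)).toLinearMap)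
    ((SchwartzMap.continuous_supSeminorm (M * N)).comp
      (FourierTransform.fourierCLM ℂ 𝓢(V, ℂ)).continuous) (M * N)
  refine ⟨|C| ^ N * (2 ^ (M * N) * K), fun i => ?_⟩
  have h1 := one_add_pow_le_supSeminorm (m := M * N) (k := M * N) (l := 0) le_rfl (Nat.zero_le _)
    (𝓕 (localize Φ (y i) f)) (-ξ i)
  rw [norm_neg, norm_iteratedFDeriv_zero] at h1
  have h2 : (1 + ‖y i‖) ^ (M * N) *
      SchwartzMap.supSeminorm V (M * N) (𝓕 (localize Φ (y i) f)) ≤ K := hK (y i)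
  change w i ^ N * ‖toDist volume (gaborAtom Φ (y i) (ξ i)) f‖ ≤ _
  rw [toDist_gaborAtom]
  calc w i ^ N * ‖𝓕 (localize Φ (y i) f) (-ξ i)‖
      ≤ (|C| * ((1 + ‖y i‖) * (1 + ‖ξ i‖)) ^ M) ^ N * ‖𝓕 (localize Φ (y i) f) (-ξ i)‖ := by
        have h3 : w i ≤ |C| * ((1 + ‖y i‖) * (1 + ‖ξ i‖)) ^ M :=
          (hw i).trans (mul_le_mul_of_nonneg_right (le_abs_self C) (by positivity))
        gcongr
        exact hw0 i
    _ = |C| ^ N * ((1 + ‖y i‖) ^ (M * N) *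
        ((1 + ‖ξ i‖) ^ (M * N) * ‖𝓕 (localize Φ (y i) f) (-ξ i)‖)) := by
        rw [mul_pow, ← pow_mul, mul_pow]; ring
    _ ≤ |C| ^ N * ((1 + ‖y i‖) ^ (M * N) *
        (2 ^ (M * N) * SchwartzMap.supSeminorm V (M * N) (𝓕 (localize Φ (y i) f)))) := by
        gcongr
    _ = |C| ^ N * (2 ^ (M * N) * ((1 + ‖y i‖) ^ (M * N) *
        SchwartzMap.supSeminorm V (M * N) (𝓕 (localize Φ (y i) f)))) := by ring
    _ ≤ _ := by gcongr

end GaborFourier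

end AbstractComposition

namespace AbstractComposition

/-! ### Fourier series of functions supported in a cube -/

section Torus

variable {κ : Type*}

/-- A continuous function that vanishes near the boundary of a unit cube descends to the torus. -/
lemma continuous_torus_of_support (c : κ → ℝ) {r : ℝ} (hr : r < 1 / 2) {h : (κ → ℝ) → ℂ}
    (hc : Continuous h) (hsupp : ∀ y, (∃ a, r ≤ |y a - c a|) → h y = 0) :
    Continuous fun t : UnitAddTorus κ =>
      h fun a => (AddCircle.equivIoc 1 (c a - 1 / 2) (t a) : ℝ) := by
  rw [continuous_iff_continuousAt]
  intro t
  -- Off the seam the lift to the cube is continuous. If some coordinate lies on the seam, it stays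
  -- away from the compact image of the support interval, so the function vanishes nearby.
  by_cases ht : ∀ a, t a ≠ ((c a - 1 / 2 : ℝ) : UnitAddCircle)
  · refine hc.continuousAt.comp (continuousAt_pi.2 fun a => ?_)
    exact (continuous_subtype_val.continuousAt.comp
      (AddCircle.continuousAt_equivIoc 1 _ (ht a))).comp (f := fun s : UnitAddTorus κ => s a)
      (continuous_apply a).continuousAt
  · push Not at ht
    obtain ⟨a, ha⟩ := ht
    set K : Set UnitAddCircle :=
      (fun y : ℝ => (y : UnitAddCircle)) '' Set.Icc (c a - r) (c a + r) with hK
    have hKc : IsClosed K :=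
      (isCompact_Icc.image (AddCircle.continuous_mk' (1 : ℝ))).isClosed
    have hzero : ∀ s : UnitAddTorus κ, s a ∉ K →
        h (fun a => (AddCircle.equivIoc 1 (c a - 1 / 2) (s a) : ℝ)) = 0 := by
      intro s hs
      refine hsupp _ ⟨a, ?_⟩
      by_contra! hlt
      rw [abs_lt] at hlt
      refine hs ⟨AddCircle.equivIoc 1 (c a - 1 / 2) (s a),
        ⟨by linarith [hlt.1], by linarith [hlt.2]⟩, ?_⟩
      exact (AddCircle.equivIoc 1 (c a - 1 / 2)).symm_apply_apply (s a)
    have htK : t a ∉ K := by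
      rintro ⟨y, ⟨hy1, hy2⟩, hy⟩
      have h1 : y ∈ Set.Ioc (c a - 1 / 2) (c a - 1 / 2 + 1) := ⟨by linarith, by linarith⟩
      have h2 : c a + 1 / 2 ∈ Set.Ioc (c a - 1 / 2) (c a - 1 / 2 + 1) :=
        ⟨by linarith, by linarith⟩
      have h3 : ((c a + 1 / 2 : ℝ) : UnitAddCircle) = ((c a - 1 / 2 : ℝ) : UnitAddCircle) := by
        rw [show c a + 1 / 2 = c a - 1 / 2 + 1 by ring]
        exact AddCircle.coe_add_period 1 _
      have h4 := AddCircle.equivIoc_coe_eq (p := (1 : ℝ)) h1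
      rw [show ((y : ℝ) : UnitAddCircle) = ((c a + 1 / 2 : ℝ) : UnitAddCircle) from
        (hy.trans ha).trans h3.symm, AddCircle.equivIoc_coe_eq h2] at h4
      have := congrArg Subtype.val h4
      simp only at this
      linarith
    have hev : (fun t : UnitAddTorus κ =>
        h fun a => (AddCircle.equivIoc 1 (c a - 1 / 2) (t a) : ℝ)) =ᶠ[𝓝 t] fun _ => 0 := by
      have : ∀ᶠ s : UnitAddTorus κ in 𝓝 t, s a ∉ K :=
        (continuous_apply a).continuousAt.eventually (hKc.isOpen_compl.mem_nhds htK)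
      filter_upwards [this] with s hs using hzero s hs
    exact continuousAt_const.congr_of_eventuallyEq hev

/-- The point of `EuclideanSpace ℝ κ` with integer coordinates `m`. -/
def intPoint (m : κ → ℤ) : EuclideanSpace ℝ κ := WithLp.toLp 2 fun a => (m a : ℝ)

@[simp] lemma intPoint_apply (m : κ → ℤ) (a : κ) : intPoint m a = m a := rfl

variable [Fintype κ]

lemma mFourier_coe (m : κ → ℤ) (x : κ → ℝ) :
    UnitAddTorus.mFourier m (fun a => (x a : UnitAddCircle))
      = Complex.exp (2 * Real.pi * Complex.I * ((∑ a, m a * x a : ℝ) : ℂ)) := by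
  simp only [UnitAddTorus.mFourier, ContinuousMap.coe_mk, fourier_coe_apply]
  rw [← Complex.exp_sum]
  congr 1
  push_cast
  rw [Finset.mul_sum]
  refine Finset.sum_congr rfl fun a _ => ?_
  ring

lemma inner_intPoint (m : κ → ℤ) (x : EuclideanSpace ℝ κ) :
    inner ℝ (intPoint m) x = ∑ a, m a * x a := by
  rw [PiLp.inner_apply]
  refine Finset.sum_congr rfl fun a _ => ?_
  simp [mul_comm]

/-- The Fourier series of a Schwartz function supported in the interior of a unit cube. -/
lemma hasSum_fourier_of_support {c : κ → ℝ} {r : ℝ} (hr : r < 1 / 2)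
    {g : 𝓢(EuclideanSpace ℝ κ, ℂ)} (hsupp : ∀ y, (∃ a, r ≤ |y a - c a|) → g y = 0)
    (hsum : Summable fun m : κ → ℤ => 𝓕 g (intPoint m)) {x : EuclideanSpace ℝ κ}
    (hx : ∀ a, |x a - c a| < r) :
    HasSum (fun m : κ → ℤ =>
      𝓕 g (intPoint m) * Complex.exp (2 * Real.pi * Complex.I * (inner ℝ (intPoint m) x : ℝ)))
      (g x) := by
  set h : (κ → ℝ) → ℂ := fun y => g (WithLp.toLp 2 y) with hh
  have hc : Continuous h := g.continuous.comp (PiLp.continuous_toLp 2 _)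
  have hs : ∀ y, (∃ a, r ≤ |y a - c a|) → h y = 0 := fun y hy => hsupp _ hy
  let G : C(UnitAddTorus κ, ℂ) := ⟨_, continuous_torus_of_support c hr hc hs⟩
  have hG : ∀ y : κ → ℝ, (∀ a, y a ∈ Set.Ioc (c a - 1 / 2) (c a - 1 / 2 + 1)) →
      G (fun a => (y a : UnitAddCircle)) = h y := by
    intro y hy
    change h _ = h _
    congr 1
    ext a
    rw [AddCircle.equivIoc_coe_eq (hy a)]
  -- The torus coefficient is an integral over the unit cube, and g vanishes outside that cube, so
  -- it equals the integral over the whole space.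
  have hcoef : ∀ m, UnitAddTorus.mFourierCoeff G m = 𝓕 g (intPoint m) := by
    intro m
    rw [UnitAddTorus.mFourierCoeff_eq_integral G m fun a => c a - 1 / 2, SchwartzMap.fourier_coe,
      Real.fourier_eq', ← (PiLp.volume_preserving_toLp κ).integral_comp
        (MeasurableEquiv.toLp 2 (κ → ℝ)).measurableEmbedding]
    refine (setIntegral_congr_fun (MeasurableSet.univ_pi' (fun i : κ =>
      (measurableSet_Ioc : MeasurableSet (Set.Ioc (c i - 1 / 2) (c i - 1 / 2 + 1)))))
      fun y hy => ?_).trans (setIntegral_eq_integral_of_forall_compl_eq_zero fun y hy => ?_)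
    · change _ • _ = _ • h y
      rw [hG y hy, mFourier_coe, real_inner_comm, inner_intPoint]
      congr 2
      simp only [Pi.neg_apply, Int.cast_neg, neg_mul, Finset.sum_neg_distrib]
      push_cast
      ring
    · have : h y = 0 := by
        refine hs y ?_
        by_contra! hlt
        refine hy fun a => ?_
        have := abs_lt.1 (hlt a)
        exact ⟨by linarith [this.1], by linarith [this.2]⟩
      change _ • h y = 0
      rw [this, smul_zero]
  have hfs := UnitAddTorus.hasSum_mFourier_series_apply_of_summable (f := G)
    (by simpa only [funext hcoef] using hsum) (fun a => (x a : UnitAddCircle))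
  rw [hG _ fun a => ?_] at hfs
  · refine hfs.congr_fun fun m => ?_
    rw [hcoef, smul_eq_mul, mFourier_coe, inner_intPoint]
  · have := abs_lt.1 (hx a)
    exact ⟨by linarith [this.1], by linarith [this.2]⟩

end Torus

end AbstractComposition

namespace AbstractComposition

/-! ### Lattice weights -/

section Weights

lemma summable_int_inv_sq : Summable fun k : ℤ => ((1 + |(k : ℝ)|) ^ 2)⁻¹ := by
  have h : Summable fun k : ℕ => ((1 + (k : ℝ)) ^ 2)⁻¹ := by
    have := (summable_nat_add_iff 1).2 (Real.summable_nat_pow_inv.2 one_lt_two)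
    refine this.congr fun k => ?_
    push_cast
    rw [add_comm]
  refine Summable.of_nat_of_neg (h.congr fun k => ?_) (h.congr fun k => ?_) <;> simp

variable {κ : Type*} [Fintype κ]

/-- Every finite set of lattice points lies in a box, over which the sum factors into
one-dimensional sums. -/
lemma summable_pi_int_inv_sq : Summable fun k : κ → ℤ => (∏ a, (1 + |(k a : ℝ)|) ^ 2)⁻¹ := by
  classical
  refine summable_of_sum_le (c := ∏ _a : κ, ∑' k : ℤ, ((1 + |(k : ℝ)|) ^ 2)⁻¹)
    (fun k => by positivity) fun s => ?_
  calc ∑ k ∈ s, (∏ a, (1 + |(k a : ℝ)|) ^ 2)⁻¹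
      ≤ ∑ k ∈ Fintype.piFinset fun a : κ => s.image fun k : κ → ℤ => k a,
          (∏ a, (1 + |(k a : ℝ)|) ^ 2)⁻¹ := by
        refine Finset.sum_le_sum_of_subset_of_nonneg (fun k hk => ?_) fun k _ _ => by positivity
        exact Fintype.mem_piFinset.2 fun a => Finset.mem_image_of_mem _ hk
    _ = ∏ a, ∑ k ∈ s.image fun k : κ → ℤ => k a, ((1 + |(k : ℝ)|) ^ 2)⁻¹ := by
        rw [Finset.prod_univ_sum]
        simp only [Finset.prod_inv_distrib]
    _ ≤ _ := Finset.prod_le_prod (fun a _ => Finset.sum_nonneg fun k _ => by positivity)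
        fun a _ => summable_int_inv_sq.sum_le_tsum _ fun k _ => by positivity

lemma one_add_norm_le_prod (x : EuclideanSpace ℝ κ) : 1 + ‖x‖ ≤ ∏ a, (1 + |x a|) := by
  have h1 : ‖x‖ ≤ ∑ a, |x a| := by
    rw [EuclideanSpace.norm_eq]
    refine Real.sqrt_le_iff.2 ⟨Finset.sum_nonneg fun a _ => abs_nonneg _, ?_⟩
    exact Finset.sum_sq_le_sq_sum_of_nonneg fun a _ => norm_nonneg (x a)
  have h2 : ∀ s : Finset κ, 1 + ∑ a ∈ s, |x a| ≤ ∏ a ∈ s, (1 + |x a|) := by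
    classical
    intro s
    induction s using Finset.induction_on with
    | empty => simp
    | insert a s ha ih =>
      rw [Finset.sum_insert ha, Finset.prod_insert ha]
      have h0 : 0 ≤ ∑ a ∈ s, |x a| := Finset.sum_nonneg fun a _ => abs_nonneg _
      nlinarith [abs_nonneg (x a)]
  linarith [h2 Finset.univ]

lemma abs_apply_le_norm (x : EuclideanSpace ℝ κ) (a : κ) : |x a| ≤ ‖x‖ :=
  PiLp.norm_apply_le x a

/-- The weight `∏ a, (1 + |k a|)² (1 + |m a|)²` on the time-frequency lattice. -/
def latticeWeight (p : (κ → ℤ) × (κ → ℤ)) : ℝ :=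
  (∏ a, (1 + |(p.1 a : ℝ)|) ^ 2) * ∏ a, (1 + |(p.2 a : ℝ)|) ^ 2

lemma one_le_prod_one_add_sq (k : κ → ℤ) : 1 ≤ ∏ a, (1 + |(k a : ℝ)|) ^ 2 :=
  Finset.prod_induction _ (1 ≤ ·) (fun _ _ => one_le_mul_of_one_le_of_one_le) le_rfl
    fun a _ => one_le_pow₀ (by linarith [abs_nonneg (k a : ℝ)])

lemma one_le_latticeWeight (p : (κ → ℤ) × (κ → ℤ)) : 1 ≤ latticeWeight p :=
  one_le_mul_of_one_le_of_one_le (one_le_prod_one_add_sq _) (one_le_prod_one_add_sq _)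

lemma summable_inv_latticeWeight :
    Summable fun p : (κ → ℤ) × (κ → ℤ) => (latticeWeight p)⁻¹ := by
  simp only [latticeWeight, mul_inv]
  exact summable_pi_int_inv_sq.mul_of_nonneg summable_pi_int_inv_sq
    (fun k => by positivity) (fun k => by positivity)

lemma one_add_norm_intPoint_le (k : κ → ℤ) : 1 + ‖intPoint k‖ ≤ ∏ a, (1 + |(k a : ℝ)|) ^ 2 :=
  (one_add_norm_le_prod _).trans <| Finset.prod_le_prod (fun a _ => by positivity) fun a _ =>
    le_self_pow₀ (a := 1 + |(k a : ℝ)|) (by linarith [abs_nonneg (k a : ℝ)]) two_ne_zero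

lemma prod_one_add_sq_le (k : κ → ℤ) :
    ∏ a, (1 + |(k a : ℝ)|) ^ 2 ≤ (1 + ‖intPoint k‖) ^ (2 * Fintype.card κ) := by
  rw [pow_mul, ← Finset.card_univ, ← Finset.prod_const]
  refine Finset.prod_le_prod (fun a _ => by positivity) fun a _ => ?_
  have := abs_apply_le_norm (intPoint k) a
  rw [intPoint_apply] at this
  gcongr

/-- The point `k / 4`. -/
def quarterPoint (k : κ → ℤ) : EuclideanSpace ℝ κ := (4 : ℝ)⁻¹ • intPoint k

lemma latticeWeight_ge (p : (κ → ℤ) × (κ → ℤ)) :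
    (1 + ‖quarterPoint p.1‖) * (1 + ‖intPoint p.2‖) ≤ latticeWeight p := by
  have h : ‖quarterPoint p.1‖ ≤ ‖intPoint p.1‖ := by
    rw [quarterPoint, norm_smul]
    refine mul_le_of_le_one_left (norm_nonneg _) ?_
    norm_num
  refine mul_le_mul ((by linarith : 1 + ‖quarterPoint p.1‖ ≤ 1 + ‖intPoint p.1‖).trans
    (one_add_norm_intPoint_le _)) (one_add_norm_intPoint_le _) (by positivity) (by positivity)

lemma latticeWeight_le (p : (κ → ℤ) × (κ → ℤ)) :
    latticeWeight p ≤ 4 ^ (2 * Fintype.card κ) *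
      ((1 + ‖quarterPoint p.1‖) * (1 + ‖intPoint p.2‖)) ^ (2 * Fintype.card κ) := by
  have h : 1 + ‖intPoint p.1‖ ≤ 4 * (1 + ‖quarterPoint p.1‖) := by
    rw [quarterPoint, norm_smul, norm_inv, Real.norm_ofNat]
    linarith [norm_nonneg (intPoint p.1)]
  rw [mul_pow, ← mul_assoc, ← mul_pow]
  refine mul_le_mul ((prod_one_add_sq_le _).trans ?_) (prod_one_add_sq_le _) (by positivity)
    (by positivity)
  gcongr

end Weights

/-! ### The window -/

section Window

/-- A smooth bump supported in `[-1, 1]` whose squared integer translates sum to one. -/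
def bump (x : ℝ) : ℝ :=
  Real.cos (Real.pi / 2 * Real.smoothTransition x) *
    Real.sin (Real.pi / 2 * Real.smoothTransition (x + 1))

lemma contDiff_bump {m : ℕ∞} : ContDiff ℝ m bump := by
  refine (Real.contDiff_cos.comp (contDiff_const.mul Real.smoothTransition.contDiff)).mul
    (Real.contDiff_sin.comp (contDiff_const.mul (Real.smoothTransition.contDiff.comp ?_)))
  exact contDiff_id.add contDiff_const

lemma bump_of_one_le {x : ℝ} (hx : 1 ≤ x) : bump x = 0 := by
  rw [bump, Real.smoothTransition.one_of_one_le hx, mul_one, Real.cos_pi_div_two, zero_mul]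

lemma bump_of_le_neg_one {x : ℝ} (hx : x ≤ -1) : bump x = 0 := by
  rw [bump, Real.smoothTransition.zero_of_nonpos (x := x + 1) (by linarith), mul_zero,
    Real.sin_zero, mul_zero]

lemma bump_of_one_le_abs {x : ℝ} (hx : 1 ≤ |x|) : bump x = 0 := by
  rcases le_abs.1 hx with h | h
  · exact bump_of_one_le h
  · exact bump_of_le_neg_one (by linarith)

/-- With t the fractional part of x and s the smooth step, the two surviving translates are cos(π
s(t)/2) and sin(π s(t)/2). -/
lemma sum_bump_sq (x : ℝ) :
    ∑ k ∈ ({⌊x⌋, ⌊x⌋ + 1} : Finset ℤ), bump (x - k) ^ 2 = 1 := by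
  have h0 := Int.fract_nonneg x
  have h1 := Int.fract_lt_one x
  rw [Finset.sum_pair (by simp)]
  have e1 : x - (⌊x⌋ : ℝ) = Int.fract x := rfl
  have e2 : x - ((⌊x⌋ + 1 : ℤ) : ℝ) = Int.fract x - 1 := by
    push_cast
    rw [← sub_sub, e1]
  rw [e1, e2, bump, bump, sub_add_cancel,
    Real.smoothTransition.one_of_one_le (x := Int.fract x + 1) (by linarith),
    Real.smoothTransition.zero_of_nonpos (x := Int.fract x - 1) (by linarith)]
  simp

lemma bump_sub_eq_zero {x : ℝ} {k : ℤ} (hk : k ∉ ({⌊x⌋, ⌊x⌋ + 1} : Finset ℤ)) :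
    bump (x - k) = 0 := by
  simp only [Finset.mem_insert, Finset.mem_singleton, not_or] at hk
  rcases lt_or_ge k ⌊x⌋ with h | h
  · refine bump_of_one_le ?_
    have h1 : ((k + 1 : ℤ) : ℝ) ≤ ⌊x⌋ := Int.cast_le.2 h
    push_cast at h1
    linarith [Int.floor_le x]
  · refine bump_of_le_neg_one ?_
    have h1 : ((⌊x⌋ + 2 : ℤ) : ℝ) ≤ k := Int.cast_le.2 (by omega)
    push_cast at h1
    linarith [Int.lt_floor_add_one x]

variable {κ : Type*} [Fintype κ]

lemma hasSum_prod_bump_sq (x : κ → ℝ) :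
    HasSum (fun k : κ → ℤ => ∏ a, bump (x a - k a) ^ 2) 1 := by
  classical
  have h := hasSum_sum_of_ne_finset_zero (L := .unconditional _)
    (f := fun k : κ → ℤ => ∏ a, bump (x a - k a) ^ 2)
    (s := Fintype.piFinset fun a => {⌊x a⌋, ⌊x a⌋ + 1}) fun k hk => by
      simp only [Fintype.mem_piFinset, not_forall] at hk
      obtain ⟨a, ha⟩ := hk
      refine Finset.prod_eq_zero (Finset.mem_univ a) ?_
      rw [bump_sub_eq_zero ha]
      norm_num
  rwa [← Finset.prod_univ_sum (fun a => {⌊x a⌋, ⌊x a⌋ + 1})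
    (fun a (k : ℤ) => bump (x a - k) ^ 2), Finset.prod_eq_one fun a _ => sum_bump_sq (x a)] at h

lemma hasCompactSupport_prod_bump :
    HasCompactSupport fun x : EuclideanSpace ℝ κ => ((∏ a, bump (4 * x a) : ℝ) : ℂ) := by
  -- A crude radius: nonvanishing forces every |x a| ≤ 1, and then 1 + ‖x‖ ≤ ∏ (1 + |x a|) ≤ 2^|κ|.
  refine HasCompactSupport.intro (isCompact_closedBall 0 (∏ _a : κ, (1 + 1 : ℝ)))
    fun x hx => ?_
  by_contra hne
  refine hx ?_
  rw [mem_closedBall_zero_iff]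
  have h1 := one_add_norm_le_prod x
  have h2 : ∏ a, (1 + |x a|) ≤ ∏ _a : κ, (1 + 1 : ℝ) := by
    refine Finset.prod_le_prod (fun a _ => by positivity) fun a _ => ?_
    by_contra! hlt
    refine hne ?_
    rw [Finset.prod_eq_zero (Finset.mem_univ a), Complex.ofReal_zero]
    refine bump_of_one_le_abs ?_
    rw [abs_mul, abs_of_pos (by norm_num : (0 : ℝ) < 4)]
    linarith
  linarith

variable (κ) in
/-- The window `x ↦ ∏ a, bump (4 x a)`. -/
def window : 𝓢(EuclideanSpace ℝ κ, ℂ) :=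
  hasCompactSupport_prod_bump.toSchwartzMap <| Complex.ofRealCLM.contDiff.comp <|
    contDiff_prod fun a _ => contDiff_bump.comp <|
      contDiff_const.mul (EuclideanSpace.proj (𝕜 := ℝ) a).contDiff

lemma window_apply (x : EuclideanSpace ℝ κ) : window κ x = ((∏ a, bump (4 * x a) : ℝ) : ℂ) := rfl

lemma window_sub_quarterPoint (x : EuclideanSpace ℝ κ) (k : κ → ℤ) :
    window κ (x - quarterPoint k) = ((∏ a, bump (4 * x a - k a) : ℝ) : ℂ) := by
  rw [window_apply]
  congr 1
  refine Finset.prod_congr rfl fun a _ => ?_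
  congr 1
  simp only [quarterPoint, PiLp.sub_apply, PiLp.smul_apply, intPoint_apply, smul_eq_mul]
  ring

lemma hasSum_window_sq (x : EuclideanSpace ℝ κ) :
    HasSum (fun k : κ → ℤ => window κ (x - quarterPoint k) ^ 2) 1 := by
  have h := Complex.hasSum_ofReal.2 (hasSum_prod_bump_sq fun a => 4 * x a)
  rw [Complex.ofReal_one] at h
  refine h.congr_fun fun k => ?_
  rw [window_sub_quarterPoint, ← Complex.ofReal_pow, Finset.prod_pow]

lemma window_sub_quarterPoint_eq_zero {x : EuclideanSpace ℝ κ} {k : κ → ℤ}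
    (h : ∃ a, 1 / 4 ≤ |x a - (k a : ℝ) / 4|) : window κ (x - quarterPoint k) = 0 := by
  obtain ⟨a, ha⟩ := h
  rw [window_sub_quarterPoint, Finset.prod_eq_zero (Finset.mem_univ a), Complex.ofReal_zero]
  refine bump_of_one_le_abs ?_
  rw [show 4 * x a - k a = 4 * (x a - k a / 4) by ring, abs_mul,
    abs_of_pos (by norm_num : (0 : ℝ) < 4)]
  linarith

end Window

end AbstractComposition

namespace AbstractComposition

/-! ### The Gabor frame of Euclidean space -/

section LatticeFrame

variable {κ κ' : Type*} [Fintype κ] [Fintype κ']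

/-- The time-frequency shifts of the window along the lattice. -/
def latticeAtom (p : (κ → ℤ) × (κ → ℤ)) : 𝓢(EuclideanSpace ℝ κ, ℂ) :=
  gaborAtom (window κ) (quarterPoint p.1) (intPoint p.2)

/-- The conjugate time-frequency shifts of the window along the lattice. -/
def latticeDual (p : (κ → ℤ) × (κ → ℤ)) : 𝓢(EuclideanSpace ℝ κ, ℂ) :=
  gaborAtom (window κ) (quarterPoint p.1) (-intPoint p.2)

lemma toDist_latticeDual (p : (κ → ℤ) × (κ → ℤ)) (f : 𝓢(EuclideanSpace ℝ κ, ℂ)) :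
    toDist volume (latticeDual p) f
      = 𝓕 (localize (window κ) (quarterPoint p.1) f) (intPoint p.2) := by
  rw [latticeDual, toDist_gaborAtom, neg_neg]

lemma rapidlyDecreasing_latticeDual (f : 𝓢(EuclideanSpace ℝ κ, ℂ)) :
    RapidlyDecreasing latticeWeight fun p => toDist volume (latticeDual p) f :=
  rapidlyDecreasing_gaborAtom _ f (fun p => zero_le_one.trans (one_le_latticeWeight p))
    fun p => by simpa only [norm_neg] using latticeWeight_le p

/-- The localised function is supported in a cube of side 1/2 about k/4, so its Fourier series with
integer frequencies reproduces it there. The second window factor, carried by the atom, removes the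
periodic copies and leaves the square of the window. -/
lemma hasSum_latticeDual_fiber (f : 𝓢(EuclideanSpace ℝ κ, ℂ)) (x : EuclideanSpace ℝ κ)
    (k : κ → ℤ) :
    HasSum (fun m => toDist volume (latticeDual (k, m)) f * latticeAtom (k, m) x)
      (f x * window κ (x - quarterPoint k) ^ 2) := by
  by_cases hx : window κ (x - quarterPoint k) = 0
  · simpa only [latticeAtom, gaborAtom_apply, hx, mul_zero, ne_eq, OfNat.ofNat_ne_zero,
      not_false_eq_true, zero_pow] using hasSum_zero
  obtain ⟨K, hK⟩ := rapidlyDecreasing_latticeDual f 1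
  have hinj : Function.Injective fun m : κ → ℤ => (k, m) := fun _ _ h => (Prod.mk.inj h).2
  have hsum : Summable fun m : κ → ℤ =>
      𝓕 (localize (window κ) (quarterPoint k) f) (intPoint m) := by
    refine Summable.of_norm_bounded
      (((summable_inv_latticeWeight (κ := κ)).comp_injective hinj).mul_right K) fun m => ?_
    have h1 : latticeWeight (k, m) ^ 1 * ‖toDist volume (latticeDual (k, m)) f‖ ≤ K := hK (k, m)
    have h0 := zero_lt_one.trans_le (one_le_latticeWeight (k, m))
    rw [toDist_latticeDual, pow_one] at h1
    rwa [Function.comp_apply, ← div_eq_inv_mul, le_div_iff₀ h0, mul_comm]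
  have h := (hasSum_fourier_of_support (c := fun a => (k a : ℝ) / 4) (r := 1 / 4) (by norm_num)
    (g := localize (window κ) (quarterPoint k) f) (fun y hy => by
      rw [localize_apply, window_sub_quarterPoint_eq_zero hy, mul_zero]) hsum (x := x)
    (fun a => by
      by_contra! hlt
      exact hx (window_sub_quarterPoint_eq_zero ⟨a, hlt⟩))).mul_right
        (window κ (x - quarterPoint k))
  rw [localize_apply, mul_assoc (f x), ← sq] at h
  refine h.congr_fun fun m => ?_
  rw [toDist_latticeDual, latticeAtom, gaborAtom_apply, ← mul_assoc]

theorem isSchwartzFrame_lattice :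
    IsSchwartzFrame volume latticeWeight (latticeAtom (κ := κ)) latticeDual where
  one_le := one_le_latticeWeight
  summable_inv := summable_inv_latticeWeight
  poly_atom := polyBounded_gaborAtom _ latticeWeight_ge
  poly_dual := polyBounded_gaborAtom _ fun p => by simpa only [norm_neg] using latticeWeight_ge p
  rapid_atom f := rapidlyDecreasing_gaborAtom _ f
    (fun p => zero_le_one.trans (one_le_latticeWeight p)) latticeWeight_le
  rapid_dual := rapidlyDecreasing_latticeDual
  expand f := by
    -- Convergence in 𝓢 is known beforehand, so the sum may be identified pointwise: over
    -- frequencies by Fourier series, then over positions by the partition of unity.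
    obtain ⟨T, hT⟩ := exists_clm_hasSum (one_le_latticeWeight (κ := κ)) summable_inv_latticeWeight
      (α := fun p => toDist volume (latticeDual p)) rapidlyDecreasing_latticeDual
      (B := latticeAtom) (polyBounded_gaborAtom _ latticeWeight_ge)
    suffices h : T f = f by
      have := hT f
      rwa [h] at this
    ext x
    have h1 := (hT f).mapL (((BoundedContinuousFunction.evalCLM ℂ x).comp
      (SchwartzMap.toBoundedContinuousFunctionCLM ℂ (EuclideanSpace ℝ κ) ℂ)))
    have h2 := h1.prod_fiberwise fun k => hasSum_latticeDual_fiber f x k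
    have h3 := (hasSum_window_sq x).mul_left (f x)
    rw [mul_one] at h3
    exact h2.unique h3

/-- Families indexed by the lattices of two spaces, as a family on the lattice of the product. -/
def latticeSumEquiv (κ κ' : Type*) :
    ((κ → ℤ) × (κ → ℤ)) × ((κ' → ℤ) × (κ' → ℤ)) ≃ (κ ⊕ κ' → ℤ) × (κ ⊕ κ' → ℤ) :=
  (Equiv.prodProdProdComm _ _ _ _).trans
    ((Equiv.sumArrowEquivProdArrow κ κ' ℤ).symm.prodCongr
      (Equiv.sumArrowEquivProdArrow κ κ' ℤ).symm)

lemma latticeWeight_sum (p : (κ → ℤ) × (κ → ℤ)) (q : (κ' → ℤ) × (κ' → ℤ)) :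
    latticeWeight (latticeSumEquiv κ κ' (p, q)) = latticeWeight p * latticeWeight q := by
  simp only [latticeWeight, latticeSumEquiv, Fintype.prod_sum_type]
  exact mul_mul_mul_comm _ _ _ _

/-- The identification of a product of Euclidean spaces with a Euclidean space. -/
def euclideanProd (κ κ' : Type*) [Fintype κ] [Fintype κ'] :
    (EuclideanSpace ℝ κ × EuclideanSpace ℝ κ') ≃L[ℝ] EuclideanSpace ℝ (κ ⊕ κ') :=
  LinearEquiv.toContinuousLinearEquiv
    { toFun := fun P => WithLp.toLp 2 (Sum.elim P.1 P.2)
      map_add' := by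
        intro P Q
        ext (i | i) <;> simp
      map_smul' := by
        intro c P
        ext (i | i) <;> simp
      invFun := fun x =>
        (WithLp.toLp 2 fun i => x (Sum.inl i), WithLp.toLp 2 fun i => x (Sum.inr i))
      left_inv := by
        intro P
        ext <;> simp
      right_inv := by
        intro x
        ext (i | i) <;> simp }

lemma measurePreserving_euclideanProd :
    MeasurePreserving (euclideanProd κ κ') (volume.prod volume) volume :=
  (PiLp.volume_preserving_toLp (κ ⊕ κ')).comp
    ((volume_measurePreserving_sumPiEquivProdPi_symm fun _ : κ ⊕ κ' => ℝ).comp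
      ((PiLp.volume_preserving_ofLp κ).prod (PiLp.volume_preserving_ofLp κ')))

/-- Both the window and the exponential are products over coordinates. The sign s = 1 serves the
atoms and s = -1 the dual atoms. -/
lemma gaborAtom_euclideanProd (k m : κ ⊕ κ' → ℤ) (s : ℝ)
    (P : EuclideanSpace ℝ κ × EuclideanSpace ℝ κ') :
    gaborAtom (window (κ ⊕ κ')) (quarterPoint k) (s • intPoint m) (euclideanProd κ κ' P)
      = gaborAtom (window κ) (quarterPoint fun i => k (Sum.inl i))
          (s • intPoint fun i => m (Sum.inl i)) P.1 *
        gaborAtom (window κ') (quarterPoint fun i => k (Sum.inr i))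
          (s • intPoint fun i => m (Sum.inr i)) P.2 := by
  have hl : ∀ i, euclideanProd κ κ' P (Sum.inl i) = P.1 i := fun i => rfl
  have hr : ∀ i, euclideanProd κ κ' P (Sum.inr i) = P.2 i := fun i => rfl
  simp only [gaborAtom_apply, window_sub_quarterPoint, real_inner_smul_left, inner_intPoint,
    Fintype.prod_sum_type, Fintype.sum_sum_type, hl, hr]
  rw [mul_mul_mul_comm, ← Complex.exp_add]
  congr 2 <;> push_cast <;> ring

end LatticeFrame

/-! ### Transport of frames -/

section Transport

variable {ι κ D E : Type*} [NormedAddCommGroup D] [NormedSpace ℝ D] [MeasurableSpace D]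
  [BorelSpace D] [SecondCountableTopology D] [NormedAddCommGroup E] [NormedSpace ℝ E]
  [MeasurableSpace E] [BorelSpace E] [SecondCountableTopology E] {μ : Measure E}
  [μ.HasTemperateGrowth] {ν : Measure D} [ν.HasTemperateGrowth] {w : ι → ℝ} {a b : ι → 𝓢(E, ℂ)}

lemma toDist_comp_of_map {e : D ≃L[ℝ] E} {c : ℝ≥0} (he : MeasurePreserving e ν (c • μ))
    (F : 𝓢(E, ℂ)) (G : 𝓢(D, ℂ)) :
    toDist ν (SchwartzMap.compCLMOfContinuousLinearEquiv ℂ e F) G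
      = (c : ℂ) * toDist μ F (SchwartzMap.compCLMOfContinuousLinearEquiv ℂ e.symm G) := by
  rw [toDist_apply, toDist_apply]
  have h1 := he.integral_comp e.toHomeomorph.measurableEmbedding
    fun x => SchwartzMap.compCLMOfContinuousLinearEquiv ℂ e.symm G x * F x
  rw [integral_smul_nnreal_measure, NNReal.smul_def, Complex.real_smul] at h1
  rw [← h1]
  refine integral_congr_ae (Eventually.of_forall fun x => ?_)
  simp

lemma RapidlyDecreasing.const_mul {w : ι → ℝ} {f : ι → ℂ} (h : RapidlyDecreasing w f)
    (c : ℂ) : RapidlyDecreasing w fun i => c * f i := by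
  intro N
  obtain ⟨C, hC⟩ := h N
  refine ⟨‖c‖ * C, fun i => ?_⟩
  rw [norm_mul, mul_left_comm]
  exact mul_le_mul_of_nonneg_left (hC i) (norm_nonneg _)

/-- A linear change of variables and a reindexing carry a frame to a frame. -/
lemma IsSchwartzFrame.transport (h : IsSchwartzFrame μ w a b) (e : D ≃L[ℝ] E) {c : ℝ≥0}
    (hc : c ≠ 0) (he : MeasurePreserving e ν (c • μ)) (σ : κ ≃ ι) :
    IsSchwartzFrame ν (fun i => w (σ i))
      (fun i => SchwartzMap.compCLMOfContinuousLinearEquiv ℂ e (a (σ i)))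
      (fun i => (c : ℂ)⁻¹ • SchwartzMap.compCLMOfContinuousLinearEquiv ℂ e (b (σ i))) where
  one_le i := h.one_le _
  summable_inv := h.summable_inv.comp_injective σ.injective
  poly_atom q hq := by
    obtain ⟨C, M, hC, hM⟩ := h.poly_atom.comp_clm
      (SchwartzMap.compCLMOfContinuousLinearEquiv ℂ e) q hq
    exact ⟨C, M, hC, fun i => hM (σ i)⟩
  poly_dual q hq := by
    obtain ⟨C, M, hC, hM⟩ := h.poly_dual.comp_clm
      ((c : ℂ)⁻¹ • SchwartzMap.compCLMOfContinuousLinearEquiv ℂ e) q hq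
    exact ⟨C, M, hC, fun i => hM (σ i)⟩
  rapid_atom f N := by
    obtain ⟨C, hC⟩ := (h.rapid_atom
      (SchwartzMap.compCLMOfContinuousLinearEquiv ℂ e.symm f)).const_mul c N
    refine ⟨C, fun i => ?_⟩
    simp only [toDist_comp_of_map he]
    exact hC (σ i)
  rapid_dual f N := by
    obtain ⟨C, hC⟩ := ((h.rapid_dual
      (SchwartzMap.compCLMOfContinuousLinearEquiv ℂ e.symm f)).const_mul c).const_mul (c : ℂ)⁻¹ N
    refine ⟨C, fun i => ?_⟩
    simp only [toDist_smul, smul_apply, smul_eq_mul, toDist_comp_of_map he]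
    exact hC (σ i)
  expand f := by
    have hc' : (c : ℂ) ≠ 0 := by exact_mod_cast hc
    have h1 := (σ.hasSum_iff.2 (h.expand
      (SchwartzMap.compCLMOfContinuousLinearEquiv ℂ e.symm f))).mapL
        (SchwartzMap.compCLMOfContinuousLinearEquiv ℂ e)
    have h2 : SchwartzMap.compCLMOfContinuousLinearEquiv ℂ e
        (SchwartzMap.compCLMOfContinuousLinearEquiv ℂ e.symm f) = f := by
      ext x
      simp
    rw [h2] at h1
    refine h1.congr_fun fun i => ?_
    simp only [toDist_smul, smul_apply, smul_eq_mul, toDist_comp_of_map he, Function.comp_apply,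
      map_smul, inv_mul_cancel_left₀ hc']

end Transport

/-! ### A tensor frame of phase space -/

/-- Since window, weight and characters factor, the lattice frame on the Euclidean space of double
dimension is the tensor square of the one on Ξ. The inverse normalising constants of the two
measures go into the dual atoms. -/
theorem exists_tensorFrame (n : ℕ) :
    ∃ (ι : Type) (w : ι → ℝ) (a b : ι → 𝓢(Phase n, ℂ)), IsTensorFrame w a b := by
  have hc := haarConst_ne_zero n
  refine ⟨_, latticeWeight, latticeAtom, fun p => (haarConst n : ℂ)⁻¹ • latticeDual p, ?_, ?_⟩
  · have h := isSchwartzFrame_lattice.transport (ν := phaseMeasure n)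
      (ContinuousLinearEquiv.refl ℝ (Phase n)) hc (MeasurePreserving.id _) (Equiv.refl _)
    exact h
  · have he : MeasurePreserving (euclideanProd (Fin n ⊕ Fin n) (Fin n ⊕ Fin n)) (doubleMeasure n)
        ((haarConst n * haarConst n) • volume) := by
      have h1 : doubleMeasure n = (haarConst n * haarConst n) •
          ((volume : Measure (Phase n)).prod (volume : Measure (Phase n))) := by
        refine Measure.prod_eq fun s t _ _ => ?_
        simp only [phaseMeasure, Measure.smul_apply, Measure.prod_prod, ENNReal.smul_def,
          smul_eq_mul, ENNReal.coe_mul]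
        exact mul_mul_mul_comm _ _ _ _
      rw [h1]
      exact measurePreserving_euclideanProd.smul_measure _
    have h := isSchwartzFrame_lattice.transport (euclideanProd (Fin n ⊕ Fin n) (Fin n ⊕ Fin n))
      (mul_ne_zero hc hc) he (latticeSumEquiv _ _)
    convert h using 1
    · ext ⟨p, q⟩
      exact (latticeWeight_sum p q).symm
    · ext ⟨p, q⟩ P
      have := gaborAtom_euclideanProd (latticeSumEquiv _ _ (p, q)).1 (latticeSumEquiv _ _ (p, q)).2
        1 P
      simp only [one_smul] at this
      exact this.symm
    · ext ⟨p, q⟩ P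
      have := gaborAtom_euclideanProd (latticeSumEquiv _ _ (p, q)).1 (latticeSumEquiv _ _ (p, q)).2
        (-1) P
      simp only [neg_smul, one_smul] at this
      rw [tensor_apply, smul_apply, smul_apply, smul_apply,
        SchwartzMap.compCLMOfContinuousLinearEquiv_apply]
      simp only [Function.comp_apply, smul_eq_mul, NNReal.coe_mul, Complex.ofReal_mul, mul_inv]
      rw [mul_mul_mul_comm]
      exact congrArg _ this.symm

end AbstractComposition

end

theorem mainTheorem3 (n : ℕ)
    (mul : 𝓢(Phase n, ℂ) →ₗ[ℂ] 𝓢(Phase n, ℂ) →ₗ[ℂ] 𝓢(Phase n, ℂ))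
    (hA : HypothesisA mul) (hB : HypothesisB hA) :
    (∃! R, IsMapR mul R) ∧ (∃! N, IsMapN mul N) ∧
    (∀ R, IsMapR mul R → RestrictsAndExtends R) ∧
    (∀ N, IsMapN mul N → RestrictsAndExtends N ∧
      RestrictsAndExtends (mapM N) ∧ RestrictsAndExtends (mapM' N)) := by
  obtain ⟨ι, w, a, b, hT⟩ := exists_tensorFrame n
  exact hT.main hA hB
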